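/- **Setting.** Let $\Theta\subset\mathbb R$ be compact and let $\mathcal Y\subset\mathbb R$ be a measurable set, both without isolated points. Let $\Lambda_\theta:\mathcal Y\to\mathbb R$ ($\theta\in\Theta$) be strictly increasing, twice differentiable transformations, differentiable in $\theta$, with $\Lambda'_\theta>0$. A dot denotes $\partial/\partial\theta$ and a prime denotes $\partial/\partial y$; $\dot\Lambda'_\theta$ is assumed to exist. Let $(Y,X)$ have law $P$ on $\mathcal Y\times\mathbb R^p$, and let $\mathcal X$ be the support of $X$. Assume that for every $\theta\in\Theta$ $$\Lambda_\theta(Y)=X\beta_\theta+\varepsilon_\theta,\qquad E[\varepsilon_\theta\mid X]=0,\qquad \operatorname{Var}(\varepsilon_\theta\mid X)=\sigma_\theta^2 \text{ (not depending on } X),$$ where $\beta_\theta\in\mathbb R^p$ is differentiable in $\theta$ and $\|\beta_\theta\|_0\le s$ with $s\ge 1$. Put $\dot\varepsilon_\theta=\dot\Lambda_\theta(Y)-X\dot\beta_\theta$, $\dot\sigma^2_\theta=\partial\sigma_\theta^2/\partial\theta$ and $c_\theta=\dot\Lambda_\theta'/\Lambda_\theta'$. If $\Theta$ is not an interval, assume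 also the regularity conditions $E[\dot\varepsilon_\theta\mid X]=0$ and that $\sigma_\theta^2$ is differentiable with $\dot\sigma^2_\theta=2E[\varepsilon_\theta\dot\varepsilon_\theta]$. **Assumptions**, with constants $c,K,M>0$ and $V,\dot V\in\mathbb N$: * (A4) $|x_j|\le K$ for all $x\in\mathcal X$ and all $j$. * (A5) $E[\varepsilon_\theta^2]\ge c$ and $E[\dot\varepsilon_\theta^2]\ge c$ for all $\theta\in\Theta$. * (A6) The transformations and their derivatives are measurable. The classes $\{\Lambda_\theta:\theta\in\Theta\}$ and $\{\dot\Lambda_\theta:\theta\in\Theta\}$ have VC (subgraph) indices at most $V$ and $\dot V$, and measurable envelopes $F$, $\dot F$ with $E[F(Y)^{14}]\le M$ and $E[\dot F(Y)^8]\le M$. * (A9) The class $\{c_\theta:\theta\in\Theta\}$ has a measurable envelope $J$ with $E[J(Y)^6]\le M$. **Score class.** Fix $C>0$. For $n\ge1$ let $\tilde{\mathcal H}(\theta)$ be the set of all $h=(h_1,h_2,h_3,h_4)$ such that * $h_1(x)=x\tilde\beta$ with $\|\tilde\beta\|_0\le Cs$ and $\|\tilde\beta-\beta_\theta\|_1\le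 Cn^{-1/4}$; * $h_2>0$ with $|h_2-\sigma_\theta^2|\le Cn^{-1/4}$; * $h_3(x)=x\tilde\beta$ with $\|\tilde\beta\|_0\le Cs$ and $\|\tilde\beta-\dot\beta_\theta\|_1\le Cn^{-1/4}$; * $h_4\in\mathbb R$ with $|h_4-\dot\sigma_\theta^2|\le Cn^{-1/4}$; more precisely, $\tilde{\mathcal H}(\theta)$ is the projection at $\theta$ of the set of families of such $h$ indexed by all of $\Theta$. Let $\Psi(\theta)$ be the class of functions on $\mathcal Y\times\mathcal X$ $$(y,x)\mapsto-\frac{h_4}{2h_2}-\frac{(\Lambda_\theta(y)-h_1(x))(\dot\Lambda_\theta(y)-h_3(x))}{h_2}+\frac{h_4}{2h_2^2}(\Lambda_\theta(y)-h_1(x))^2+c_\theta(y),\qquad h\in\tilde{\mathcal H}(\theta).$$ **Theorem.** There are $q\ge4$, $C_1,C_2>0$ and $n_1\in\mathbb N$, depending only on $c,C,K,M,V,\dot V$ (so not on $\theta,n,p,s,P$), such that the following holds for every $n\ge n_1$ and every such model. There is a measurable $\bar\psi$, not depending on $\theta$, with $E[\bar\psi(Y,X)^q]\le C_1$ and, for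 every $\theta\in\Theta$: 1. $|f|\le\bar\psi$ on $\mathcal Y\times\mathcal X$ for all $f\in\Psi(\theta)$. 2. $\Psi(\theta)$ is pointwise measurable: it consists of measurable functions and has a countable subclass such that each member of $\Psi(\theta)$ is the pointwise limit of a sequence in that subclass. 3. For all $0<\varepsilon\le1$, $$\sup_Q\log N(\varepsilon\|\bar\psi\|_{Q,2},\Psi(\theta),L_2(Q))\le C_1\,s\,\log\Big(\frac{C_2\,(p\vee n)}{\varepsilon}\Big).$$ In 3, the supremum is over all probability measures $Q$ on $\mathcal Y\times\mathcal X$ with $0<\|\bar\psi\|_{Q,2}<\infty$, and $N(\delta,\mathcal F,L_2(Q))$ is the least number of open $L_2(Q)$-balls of radius $\delta$ needed to cover $\mathcal F$. -/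

import Mathlib

open MeasureTheory ProbabilityTheory Filter Topology Set
open scoped ENNReal

noncomputable section

namespace HDTransform

/-! ### Covering numbers, uniform entropy, pointwise measurable classes, VC index -/

section Classes

variable {Z : Type*} [MeasurableSpace Z]

/-- The covering number `N(δ, 𝓕, L_r(Q))`: the least number of open balls
`{f : ‖g - f‖_{Q,r} < δ}`, with centres `g` in `L_r(Q)` (not necessarily in `𝓕`), that cover the
class `𝓕`; it is `⊤` if no finite number of balls does. -/
def coveringNumber (Q : Measure Z) (r δ : ℝ≥0∞) (𝓕 : Set (Z → ℝ)) : ℕ∞ :=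
  ⨅ (T : Finset (Z → ℝ)) (_ : ∀ g ∈ T, MemLp g r Q)
    (_ : ∀ f ∈ 𝓕, ∃ g ∈ T, eLpNorm (g - f) r Q < δ), (T.card : ℕ∞)

/-- The uniform entropy number
`sup_Q log N(ε ‖F‖_{Q,r}, 𝓕, L_r(Q))` of a class `𝓕` of functions on the set `D` with envelope `F`;
the supremum is over all probability measures `Q` on `D` with `0 < ‖F‖_{Q,r} < ∞`. -/
def uniformEntropy (D : Set Z) (r : ℝ≥0∞) (𝓕 : Set (Z → ℝ)) (F : Z → ℝ) (ε : ℝ) : EReal :=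
  ⨆ (Q : Measure Z) (_ : IsProbabilityMeasure Q) (_ : Q Dᶜ = 0)
    (_ : 0 < eLpNorm F r Q) (_ : eLpNorm F r Q < ⊤),
    ENNReal.log ((coveringNumber Q r (ENNReal.ofReal ε * eLpNorm F r Q) 𝓕 : ℕ∞) : ℝ≥0∞)

/-- `F` is an envelope on `D` of the class `𝓕`. -/
def IsEnvelope (D : Set Z) (𝓕 : Set (Z → ℝ)) (F : Z → ℝ) : Prop :=
  ∀ f ∈ 𝓕, ∀ z ∈ D, |f z| ≤ F z

/-- The class `𝓕` of functions on `D` is pointwise measurable: its members are measurable on `D`,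
and it has a countable subclass `𝓖` such that every member of `𝓕` is the pointwise limit on `D` of
a sequence in `𝓖`. -/
def IsPointwiseMeasurable (D : Set Z) (𝓕 : Set (Z → ℝ)) : Prop :=
  (∀ f ∈ 𝓕, Measurable (D.domRestrict f)) ∧
  ∃ 𝓖 ⊆ 𝓕, 𝓖.Countable ∧
    ∀ f ∈ 𝓕, ∃ g : ℕ → Z → ℝ, (∀ k, g k ∈ 𝓖) ∧
      ∀ z ∈ D, Tendsto (fun k => g k z) atTop (𝓝 (f z))

end Classes

/-- The collection `𝓒` of sets shatters the finite set `A`. -/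
def Shatters {S : Type*} (𝓒 : Set (Set S)) (A : Finset S) : Prop :=
  ∀ B ⊆ (A : Set S), ∃ c ∈ 𝓒, c ∩ (A : Set S) = B

/-- The VC index of a collection of sets: the least `k` such that no set with `k` points is
shattered (`⊤` if there is none). -/
def vcIndex {S : Type*} (𝓒 : Set (Set S)) : ℕ∞ :=
  ⨅ (k : ℕ) (_ : ∀ A : Finset S, A.card = k → ¬ Shatters 𝓒 A), (k : ℕ∞)

/-- The VC index of a class of real functions on `D`, that is, of the collection of their
subgraphs `{(y, t) : y ∈ D, t < f y}`. -/
def vcSubgraphIndex {S : Type*} (D : Set S) (𝓕 : Set (S → ℝ)) : ℕ∞ :=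
  vcIndex ((fun f : S → ℝ => {q : S × ℝ | q.1 ∈ D ∧ q.2 < f q.1}) '' 𝓕)

/-! ### The transformation model -/

/-- The data of a transformation model with `p` covariates: the parameter set `Θ`, the domain
`𝒴` of the transformations, the transformations `Λ θ y`, the coefficients `β θ`, the error
variances `σsq θ`, and the law `P` of `(Y, X)`. Only the values at `θ ∈ Θ`, `y ∈ 𝒴` matter. -/
structure ModelData (p : ℕ) where
  Θ : Set ℝ
  𝒴 : Set ℝ
  Λ : ℝ → ℝ → ℝ
  β : ℝ → (Fin p → ℝ)
  σsq : ℝ → ℝ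
  P : Measure (ℝ × (Fin p → ℝ))

namespace ModelData

variable {p : ℕ} (m : ModelData p)

/-- `∂Λ_θ(y)/∂θ`. -/
def Λdot (θ y : ℝ) : ℝ := derivWithin (fun t => m.Λ t y) m.Θ θ

/-- `∂Λ_θ(y)/∂y`. -/
def Λprime (θ y : ℝ) : ℝ := derivWithin (m.Λ θ) m.𝒴 y

/-- The mixed derivative `∂/∂y (∂Λ_θ(y)/∂θ)`. -/
def Λdotprime (θ y : ℝ) : ℝ := derivWithin (m.Λdot θ) m.𝒴 y

/-- `∂β_θ/∂θ`. -/
def βdot (θ : ℝ) : Fin p → ℝ := derivWithin m.β m.Θ θ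

/-- `∂σ²_θ/∂θ`. -/
def σsqdot (θ : ℝ) : ℝ := derivWithin m.σsq m.Θ θ

/-- The error `ε_θ = Λ_θ(Y) - X β_θ`. -/
def err (θ : ℝ) (z : ℝ × (Fin p → ℝ)) : ℝ := m.Λ θ z.1 - z.2 ⬝ᵥ m.β θ

/-- The derivative of the error, `∂Λ_θ(Y)/∂θ - X ∂β_θ/∂θ`. -/
def errdot (θ : ℝ) (z : ℝ × (Fin p → ℝ)) : ℝ := m.Λdot θ z.1 - z.2 ⬝ᵥ m.βdot θ

/-- `c_θ(y)`, the quotient of the mixed derivative by `∂Λ_θ(y)/∂y`. -/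
def cfun (θ y : ℝ) : ℝ := m.Λdotprime θ y / m.Λprime θ y

/-- The σ-algebra generated by `X`. -/
abbrev σX (p : ℕ) : MeasurableSpace (ℝ × (Fin p → ℝ)) :=
  MeasurableSpace.comap (Prod.snd : ℝ × (Fin p → ℝ) → (Fin p → ℝ)) inferInstance

/-- `𝒳`, the support of `X`. -/
def 𝒳 : Set (Fin p → ℝ) := (m.P.map Prod.snd).support

/-- The set `𝒴 × 𝒳` on which the score functions live. -/
def domain : Set (ℝ × (Fin p → ℝ)) := m.𝒴 ×ˢ m.𝒳

/-- Validity of the equation for `∂Λ_θ(Y)/∂θ` and of the formula for the derivative of the error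
variance: `∂/∂θ` may be interchanged with `E[ · | X]` and with `E`. -/
def Interchange : Prop :=
  ∀ θ ∈ m.Θ,
    m.P[fun z => m.Λdot θ z.1 | σX p] =ᵐ[m.P] (fun z => z.2 ⬝ᵥ m.βdot θ) ∧
    HasDerivWithinAt m.σsq (2 * ∫ z, m.err θ z * m.errdot θ z ∂m.P) m.Θ θ

/-- The standing assumptions of the transformation model. -/
structure IsModel : Prop where
  prob : IsProbabilityMeasure m.P
  compact : IsCompact m.Θ
  /-- derivatives in `θ` are meaningful: `Θ` has no isolated points -/
  uniqueDiff_Θ : UniqueDiffOn ℝ m.Θ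
  measurableSet_𝒴 : MeasurableSet m.𝒴
  /-- derivatives in `y` are meaningful: `𝒴` has no isolated points -/
  uniqueDiff_𝒴 : UniqueDiffOn ℝ m.𝒴
  mem_𝒴 : ∀ᵐ z ∂m.P, z.1 ∈ m.𝒴
  strictMono : ∀ θ ∈ m.Θ, StrictMonoOn (m.Λ θ) m.𝒴
  diff_y : ∀ θ ∈ m.Θ, DifferentiableOn ℝ (m.Λ θ) m.𝒴
  diff_yy : ∀ θ ∈ m.Θ, DifferentiableOn ℝ (m.Λprime θ) m.𝒴
  diff_θ : ∀ y ∈ m.𝒴, DifferentiableOn ℝ (fun t => m.Λ t y) m.Θ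
  diff_θy : ∀ θ ∈ m.Θ, DifferentiableOn ℝ (m.Λdot θ) m.𝒴
  /-- the quotient `c_θ` is defined -/
  Λprime_pos : ∀ θ ∈ m.Θ, ∀ y ∈ m.𝒴, 0 < m.Λprime θ y
  /-- `E[Λ_θ(Y) | X] = X β_θ` -/
  regression : ∀ θ ∈ m.Θ,
    m.P[fun z => m.Λ θ z.1 | σX p] =ᵐ[m.P] (fun z => z.2 ⬝ᵥ m.β θ)
  /-- `Var(ε_θ | X)` does not depend on `X`, and `σ²_θ` is its value -/
  condVar : ∀ θ ∈ m.Θ,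
    m.P[fun z => m.err θ z ^ 2 | σX p] =ᵐ[m.P] (fun _ => m.σsq θ)
  diff_β : DifferentiableOn ℝ m.β m.Θ
  /-- Regularity in `θ`. If `Θ` is an interval nothing is assumed here (the interchange is then a
  consequence of the moment assumptions on the envelopes). -/
  regular : m.Θ.OrdConnected ∨ m.Interchange

/-- `‖β_θ‖₀ ≤ s` for all `θ`. -/
def IsSparse (s : ℕ) : Prop := ∀ θ ∈ m.Θ, hammingNorm (m.β θ) ≤ s

/-- The support of the regressor is bounded: `|x_j| ≤ K` for all `x ∈ 𝒳` and all `j`. -/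
def BoundedSupport (K : ℝ) : Prop := ∀ x ∈ m.𝒳, ∀ j, |x j| ≤ K

/-- The error variances in both regression equations are bounded away from zero by `c`. -/
def ErrorVarianceBound (c : ℝ) : Prop :=
  ∀ θ ∈ m.Θ, c ≤ ∫ z, m.err θ z ^ 2 ∂m.P ∧ c ≤ ∫ z, m.errdot θ z ^ 2 ∂m.P

/-- The transformations and their derivatives are measurable; the classes of the `Λ_θ` and of the
`∂Λ_θ/∂θ` have VC index at most `V` and `Vdot`, and envelopes whose moments of order 14 and 8 are
bounded by `M`. -/
def TransformationComplexity (V Vdot : ℕ) (M : ℝ) : Prop :=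
  (∀ θ ∈ m.Θ, Measurable (m.𝒴.domRestrict (m.Λ θ)) ∧ Measurable (m.𝒴.domRestrict (m.Λdot θ)) ∧
    Measurable (m.𝒴.domRestrict (m.Λprime θ)) ∧ Measurable (m.𝒴.domRestrict (m.Λdotprime θ))) ∧
  vcSubgraphIndex m.𝒴 (m.Λ '' m.Θ) ≤ V ∧
  vcSubgraphIndex m.𝒴 (m.Λdot '' m.Θ) ≤ Vdot ∧
  (∃ F : ℝ → ℝ, Measurable F ∧ IsEnvelope m.𝒴 (m.Λ '' m.Θ) F ∧
    Integrable (fun z => F z.1 ^ 14) m.P ∧ ∫ z, F z.1 ^ 14 ∂m.P ≤ M) ∧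
  (∃ Fdot : ℝ → ℝ, Measurable Fdot ∧ IsEnvelope m.𝒴 (m.Λdot '' m.Θ) Fdot ∧
    Integrable (fun z => Fdot z.1 ^ 8) m.P ∧ ∫ z, Fdot z.1 ^ 8 ∂m.P ≤ M)

/-- The class of the `c_θ` has an envelope whose moment of order 6 is bounded by `M`. -/
def QuotientEnvelope (M : ℝ) : Prop :=
  ∃ J : ℝ → ℝ, Measurable J ∧ IsEnvelope m.𝒴 (m.cfun '' m.Θ) J ∧
    Integrable (fun z => J z.1 ^ 6) m.P ∧ ∫ z, J z.1 ^ 6 ∂m.P ≤ M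

/-! ### Nuisance realization set and score class -/

/-- Functions `(θ, x) ↦ x β̃_θ` with `‖β̃_θ‖₀ ≤ C s` and `‖β̃_θ - b_θ‖₁ ≤ C n^{-1/4}`. -/
def linearRealizations (n s : ℕ) (C : ℝ) (b : ℝ → (Fin p → ℝ)) :
    Set (ℝ → (Fin p → ℝ) → ℝ) :=
  {h | ∃ βt : ℝ → (Fin p → ℝ), ∀ θ ∈ m.Θ,
    (∀ x, h θ x = x ⬝ᵥ βt θ) ∧
    (hammingNorm (βt θ) : ℝ) ≤ C * s ∧
    ∑ j, |βt θ j - b θ j| ≤ C * (n : ℝ) ^ (-(1 / 4) : ℝ)}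

def H₁ (n s : ℕ) (C : ℝ) : Set (ℝ → (Fin p → ℝ) → ℝ) := m.linearRealizations n s C m.β

def H₂ (n : ℕ) (C : ℝ) : Set (ℝ → ℝ) :=
  {h | ∀ θ ∈ m.Θ, 0 < h θ ∧ |h θ - m.σsq θ| ≤ C * (n : ℝ) ^ (-(1 / 4) : ℝ)}

def H₃ (n s : ℕ) (C : ℝ) : Set (ℝ → (Fin p → ℝ) → ℝ) := m.linearRealizations n s C m.βdot

def H₄ (n : ℕ) (C : ℝ) : Set (ℝ → ℝ) :=
  {h | ∀ θ ∈ m.Θ, |h θ - m.σsqdot θ| ≤ C * (n : ℝ) ^ (-(1 / 4) : ℝ)}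

/-- The projection at `θ` of the nuisance realization set `H₁ × H₂ × H₃ × H₄`. -/
def realizationsAt (n s : ℕ) (C θ : ℝ) :
    Set (((Fin p → ℝ) → ℝ) × ℝ × ((Fin p → ℝ) → ℝ) × ℝ) :=
  {h | ∃ h₁ ∈ m.H₁ n s C, ∃ h₂ ∈ m.H₂ n C, ∃ h₃ ∈ m.H₃ n s C, ∃ h₄ ∈ m.H₄ n C,
    h = (h₁ θ, h₂ θ, h₃ θ, h₄ θ)}

/-- The score `ψ((y, x), θ, h)`, with `h = (h₁, h₂, h₃, h₄)` the nuisance functions at `θ`. -/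
def score (θ : ℝ) (h : ((Fin p → ℝ) → ℝ) × ℝ × ((Fin p → ℝ) → ℝ) × ℝ)
    (z : ℝ × (Fin p → ℝ)) : ℝ :=
  - (h.2.2.2 / (2 * h.2.1))
  - 1 / h.2.1 * (m.Λ θ z.1 - h.1 z.2) * (m.Λdot θ z.1 - h.2.2.1 z.2)
  + h.2.2.2 / (2 * h.2.1 ^ 2) * (m.Λ θ z.1 - h.1 z.2) ^ 2
  + m.cfun θ z.1

/-- The score class `Ψ(θ)`. -/
def scoreClass (n s : ℕ) (C θ : ℝ) : Set (ℝ × (Fin p → ℝ) → ℝ) :=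
  m.score θ '' m.realizationsAt n s C θ

end ModelData

end HDTransform

end

/-! For fixed `θ` the score depends on the nuisance `h` only through two sparse vectors and two
numbers, and it is a polynomial in `1/h₂`, `h₄` and the residuals `Λ_θ(y) - h₁(x)`, `Λdot_θ(y) -
h₃(x)`, plus `c_θ(y)`, which does not involve `h`. The class is therefore a Lipschitz image of a
parameter set with few degrees of freedom. Choosing supports and gridding the nonzero coordinates
costs a power of `(p ∨ n)/ε` with exponent of order `s` (`exists_net_sparse`,
`uniformEntropy_le_of_sparse_lipschitz`), and continuity in the parameters gives pointwise
measurability.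

The real work is an envelope that does not depend on `θ`, holds everywhere on `𝒴 × 𝒳`, and has
moments free of `p` and `s`. The predictors `x β_θ` and `x βdot_θ` cannot be bounded through `|x_j|
≤ K`, since nothing bounds the `ℓ₁`-norms of the coefficients. Instead `Xβ_θ = E[Λ_θ(Y) | X]` is
dominated by `E[F(Y) | X]`, and `Xβdot_θ` by `E[Fdot(Y) | X]`; conditional Jensen transfers the
moments. `exists_linear_envelope` turns these almost sure bounds, one for each `θ`, into a single
envelope valid at every point of the support. The bound `K` only enters for differences of
coefficients, which are small in `ℓ₁`.

With `W` the sum of the four envelopes, the score is at most a constant times `(1 + W)²` plus `|J|`,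
and its increments obey the same bound times the distance of the parameters. Fourth moments then
need eighth moments of `W`. -/

namespace HDTransform

/-! ### Covering numbers from finite codes -/

section Covering

variable {Z : Type*} [MeasurableSpace Z]

/-- If finitely many labels suffice to label all members of `𝓕`, and members with a common label are
closer than `δ`, then the covering number is at most the number of labels. -/
theorem coveringNumber_le_card {ι : Type*} {Q : Measure Z} {r δ : ℝ≥0∞} {𝓕 : Set (Z → ℝ)}
    (T : Finset ι) (R : ι → (Z → ℝ) → Prop) (hmem : ∀ f ∈ 𝓕, MemLp f r Q)
    (hcov : ∀ f ∈ 𝓕, ∃ t ∈ T, R t f)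
    (hdist : ∀ t ∈ T, ∀ f ∈ 𝓕, ∀ g ∈ 𝓕, R t f → R t g → eLpNorm (g - f) r Q < δ) :
    coveringNumber Q r δ 𝓕 ≤ T.card := by
  classical
  -- Centres are taken inside `𝓕`, one per label in use, so that they lie in `L_r(Q)`; the value `0`
  -- at the other labels is filtered out below.
  have hex : ∀ t : ι, ∃ g : Z → ℝ, (∃ f ∈ 𝓕, R t f) → g ∈ 𝓕 ∧ R t g := by
    intro t
    by_cases h : ∃ f ∈ 𝓕, R t f
    · obtain ⟨f, hf, hR⟩ := h
      exact ⟨f, fun _ => ⟨hf, hR⟩⟩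
    · exact ⟨0, fun h' => absurd h' h⟩
  choose c hc using hex
  have hLp : ∀ g ∈ (T.filter fun t => ∃ f ∈ 𝓕, R t f).image c, MemLp g r Q := by
    intro g hg
    obtain ⟨t, ht, rfl⟩ := Finset.mem_image.1 hg
    exact hmem _ (hc t (Finset.mem_filter.1 ht).2).1
  have hball : ∀ f ∈ 𝓕, ∃ g ∈ (T.filter fun t => ∃ f ∈ 𝓕, R t f).image c,
      eLpNorm (g - f) r Q < δ := by
    intro f hf
    obtain ⟨t, ht, hR⟩ := hcov f hf
    have hct := hc t ⟨f, hf, hR⟩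
    exact ⟨c t, Finset.mem_image_of_mem _ (Finset.mem_filter.2 ⟨ht, f, hf, hR⟩),
      hdist t ht f hf _ hct.1 hR hct.2⟩
  unfold coveringNumber
  refine (iInf_le _ ((T.filter fun t => ∃ f ∈ 𝓕, R t f).image c)).trans ?_
  refine (iInf_le _ hLp).trans ((iInf_le _ hball).trans ?_)
  exact_mod_cast Finset.card_image_le.trans (Finset.card_filter_le _ _)

/-- A finite net of an interval. -/
theorem exists_net_interval (b C : ℝ) {η : ℝ} (hη : 0 < η) :
    ∃ T : Finset ℝ, T.card ≤ ⌊2 * C / η⌋₊ + 1 ∧ ∀ a, |a - b| ≤ C → ∃ t ∈ T, |a - t| ≤ η := by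
  classical
  refine ⟨(Finset.range (⌊2 * C / η⌋₊ + 1)).image fun i : ℕ => b - C + η * i,
    Finset.card_image_le.trans (by simp), fun a ha => ?_⟩
  obtain ⟨h1, h2⟩ := abs_le.1 ha
  refine ⟨_, Finset.mem_image_of_mem _ (a := ⌊(a - b + C) / η⌋₊) (Finset.mem_range.2 ?_), ?_⟩
  · refine Nat.lt_succ_of_le (Nat.floor_le_floor ?_)
    gcongr
    linarith
  · have h0 : 0 ≤ (a - b + C) / η := div_nonneg (by linarith) hη.le
    have h3 := Nat.floor_le h0
    have h4 := Nat.lt_floor_add_one ((a - b + C) / η)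
    rw [le_div_iff₀ hη] at h3
    rw [div_lt_iff₀ hη] at h4
    rw [abs_le]
    constructor <;> nlinarith

/-- A finite `ℓ₁`-net of the sparse vectors whose nonzero coordinates are close to those of `b`. -/
theorem exists_net_sparse {p : ℕ} (b : Fin p → ℝ) (C : ℝ) {η : ℝ} (hη : 0 < η) (k : ℕ) :
    ∃ T : Finset (Fin p → ℝ), T.card ≤ (p * (⌊2 * C / η⌋₊ + 1) + 1) ^ k ∧
      ∀ u : Fin p → ℝ, hammingNorm u ≤ k → (∀ j, u j ≠ 0 → |u j - b j| ≤ C) →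
        ∃ t ∈ T, ∑ j, |u j - t j| ≤ k * η := by
  classical
  induction k with
  | zero =>
    refine ⟨{0}, by simp, fun u hu _ => ⟨0, by simp, ?_⟩⟩
    have : u = 0 := by simpa using hu
    simp [this]
  | succ k ih =>
    obtain ⟨T, hT, hcov⟩ := ih
    obtain ⟨g, hg, hgcov⟩ := exists_net_interval 0 C hη
    -- A net point of the next level corrects an old one by `b j + a` at a single coordinate. The
    -- label `none` serves `u = 0`, which has no coordinate to remove; this is the `+ 1` in the
    -- cardinality.
    let step : (Fin p → ℝ) × Option (Fin p × ℝ) → (Fin p → ℝ) := fun q =>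
      match q.2 with
      | none => q.1
      | some (j, a) => fun i => q.1 i + Pi.single (M := fun _ => ℝ) j (b j + a) i
    refine ⟨(T ×ˢ (Finset.insertNone (Finset.univ ×ˢ g))).image step, ?_, fun u hu hb => ?_⟩
    · refine Finset.card_image_le.trans ?_
      rw [Finset.card_product, Finset.card_insertNone, Finset.card_product, Finset.card_univ,
        Fintype.card_fin, pow_succ]
      gcongr
    · by_cases hu0 : u = 0
      · obtain ⟨t, ht, hd⟩ := hcov u (by simp [hu0]) hb
        refine ⟨t, Finset.mem_image.2 ⟨(t, none), by simp [ht], rfl⟩, hd.trans ?_⟩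
        push_cast
        nlinarith
      · obtain ⟨j, hj⟩ := Function.ne_iff.1 hu0
        have hj' : u j ≠ 0 := hj
        obtain ⟨a, ha, had⟩ := hgcov (u j - b j) (by simpa using hb j hj')
        have hsub : hammingNorm (Function.update u j 0) + 1 ≤ hammingNorm u := by
          unfold hammingNorm
          rw [← Finset.card_erase_add_one (s := Finset.univ.filter fun i => u i ≠ 0) (a := j)
            (by simp [hj'])]
          gcongr
          intro i hi
          by_cases hij : i = j
          · subst hij; simp at hi
          · simpa [hij] using hi
        -- Closeness to `b` is required only at nonzero coordinates, so it survives setting `u j` to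
        -- zero.
        obtain ⟨t, ht, hd⟩ := hcov (Function.update u j 0) (by omega) (by
          intro i hi
          by_cases hij : i = j
          · subst hij; simp at hi
          · simp only [Function.update_of_ne hij] at hi ⊢
            exact hb i hi)
        refine ⟨step (t, some (j, a)), Finset.mem_image_of_mem _ (by simp [ht, ha]), ?_⟩
        calc ∑ i, |u i - step (t, some (j, a)) i|
            ≤ ∑ i, (|Function.update u j 0 i - t i| + if i = j then |u j - b j - a| else 0) := by
              refine Finset.sum_le_sum fun i _ => ?_
              by_cases hij : i = j
              · subst hij
                simp only [step, Pi.single_eq_same, Function.update_self, if_true]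
                have : u i - (t i + (b i + a)) = (0 - t i) + (u i - b i - a) := by ring
                rw [this]
                exact abs_add_le _ _
              · simp [step, hij]
          _ = ∑ i, |Function.update u j 0 i - t i| + |u j - b j - a| := by
              rw [Finset.sum_add_distrib]; simp
          _ ≤ k * η + η := add_le_add hd had
          _ = _ := by push_cast; ring

/-- A class of functions indexed by two sparse vectors and two numbers, Lipschitz in the index
relative to its envelope, has small uniform entropy. -/
theorem uniformEntropy_le_of_sparse_lipschitz {p n s : ℕ} {C ε : ℝ} (hn : 1 ≤ n) (hs : 1 ≤ s)
    (hC : 0 ≤ C) (hε : 0 < ε) (hε1 : ε ≤ 1)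
    {D : Set Z} (hD : MeasurableSet D)
    (U : Set ((Fin p → ℝ) × ℝ × (Fin p → ℝ) × ℝ))
    (φ : (Fin p → ℝ) × ℝ × (Fin p → ℝ) × ℝ → Z → ℝ) (F : Z → ℝ) (hF : Measurable F)
    (b₁ b₃ : Fin p → ℝ) (b₂ b₄ : ℝ)
    (h₁ : ∀ u ∈ U, (hammingNorm u.1 : ℝ) ≤ C * s ∧ ∀ j, |u.1 j - b₁ j| ≤ C)
    (h₂ : ∀ u ∈ U, |u.2.1 - b₂| ≤ C)
    (h₃ : ∀ u ∈ U, (hammingNorm u.2.2.1 : ℝ) ≤ C * s ∧ ∀ j, |u.2.2.1 j - b₃ j| ≤ C)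
    (h₄ : ∀ u ∈ U, |u.2.2.2 - b₄| ≤ C)
    (hmeas : ∀ u ∈ U, Measurable (D.domRestrict (φ u)))
    (henv : ∀ u ∈ U, ∀ z ∈ D, |φ u z| ≤ F z)
    (hlip : ∀ u ∈ U, ∀ v ∈ U, ∀ η : ℝ, 0 ≤ η → ∑ j, |u.1 j - v.1 j| ≤ η → |u.2.1 - v.2.1| ≤ η →
      ∑ j, |u.2.2.1 j - v.2.2.1 j| ≤ η → |u.2.2.2 - v.2.2.2| ≤ η →
      ∀ z ∈ D, |φ u z - φ v z| ≤ η * F z) :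
    uniformEntropy D 2 (φ '' U) F ε ≤
      (((4 * C + 4) * s * Real.log ((16 * C + 2) * (max p n : ℕ) / ε) : ℝ) : EReal) := by
  classical
  set m : ℕ := max p n with hm
  have hm1 : 1 ≤ m := hn.trans (le_max_right _ _)
  have hpm : p ≤ m := le_max_left _ _
  set B : ℝ := (16 * C + 2) * m / ε with hB
  have hm1' : (1 : ℝ) ≤ m := by exact_mod_cast hm1
  have hpm' : (p : ℝ) ≤ m := by exact_mod_cast hpm
  have hs' : (1 : ℝ) ≤ s := by exact_mod_cast hs
  have hmε : (1 : ℝ) ≤ m / ε := by rw [le_div_iff₀ hε]; linarith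
  have hB1 : 1 ≤ B := by
    have : B = (16 * C + 2) * (m / ε) := by rw [hB]; ring
    nlinarith
  -- Capping the sparsity at `p` gives `k * η ≤ ε / 4` for a mesh that does not involve `s`. Hence
  -- `s` enters the count only through the exponent.
  set k : ℕ := min ⌊C * s⌋₊ p with hk
  set η : ℝ := ε / (4 * (p + 1)) with hηdef
  have hη : 0 < η := by positivity
  set N : ℕ := ⌊2 * C / η⌋₊ + 1 with hN
  have hNle : (N : ℝ) ≤ (16 * C + 1) * m / ε := by
    have h1 : (⌊2 * C / η⌋₊ : ℝ) ≤ 2 * C / η := Nat.floor_le (by positivity)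
    have h2 : 2 * C / η = 8 * C * (p + 1) / ε := by
      rw [hηdef, div_div_eq_mul_div]; ring
    have h3 : 8 * C * (p + 1) / ε ≤ 16 * C * (m / ε) := by
      rw [show 16 * C * (m / ε) = 8 * C * (2 * m) / ε by ring]
      have : (p : ℝ) + 1 ≤ 2 * m := by linarith
      gcongr
    rw [hN]; push_cast
    rw [show (16 * C + 1) * m / ε = 16 * C * (m / ε) + m / ε by ring]
    linarith
  have hNB : (N : ℝ) ≤ B ^ 2 := by
    have : (N : ℝ) ≤ B := hNle.trans (by rw [hB]; gcongr; linarith)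
    nlinarith
  -- The choice of a coordinate and of a grid value each cost a factor of order `m / ε`, so `B ^ 2`
  -- pays for one nonzero entry. Two sparse vectors and two numbers then need at most `B ^ (4 * k +
  -- 4)` labels.
  have hpNB : (p * N + 1 : ℝ) ≤ B ^ 2 := by
    have h1 : (p * N : ℝ) ≤ m / ε * ((16 * C + 1) * (m / ε)) := by
      have : (p : ℝ) ≤ m / ε := hpm'.trans (by rw [le_div_iff₀ hε]; nlinarith)
      rw [← mul_div_assoc (16 * C + 1)]
      gcongr
    have h2 : B = (16 * C + 2) * (m / ε) := by rw [hB]; ring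
    have h3 : 1 ≤ (m / ε) ^ 2 := one_le_pow₀ hmε
    rw [h2]
    nlinarith [mul_nonneg hC (zero_le_one.trans h3), mul_nonneg (mul_nonneg hC hC) (zero_le_one.trans h3)]
  obtain ⟨T₁, hT₁, hc₁⟩ := exists_net_sparse b₁ C hη k
  obtain ⟨T₃, hT₃, hc₃⟩ := exists_net_sparse b₃ C hη k
  obtain ⟨T₂, hT₂, hc₂⟩ := exists_net_interval b₂ C hη
  obtain ⟨T₄, hT₄, hc₄⟩ := exists_net_interval b₄ C hη
  have hkη : k * η ≤ ε / 4 := by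
    have : (k : ℝ) ≤ p := by exact_mod_cast min_le_right _ _
    rw [hηdef, mul_div_assoc', div_le_div_iff₀ (by positivity) (by positivity)]
    nlinarith
  have hη4 : η ≤ ε / 4 := by
    rw [hηdef]
    gcongr
    have : (0 : ℝ) ≤ p := by positivity
    linarith
  have hksparse : ∀ u : Fin p → ℝ, (hammingNorm u : ℝ) ≤ C * s → hammingNorm u ≤ k := fun u hu =>
    le_min (Nat.le_floor hu) (hammingNorm_le_card_fintype.trans (by simp))
  set T := T₁ ×ˢ T₂ ×ˢ T₃ ×ˢ T₄ with hT
  have hcard : (T.card : ℝ) ≤ B ^ (4 * k + 4) := by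
    have e1 : (T₁.card : ℝ) ≤ (B ^ 2) ^ k := by
      refine le_trans (b := ((p * N + 1 : ℕ) : ℝ) ^ k) (by exact_mod_cast hT₁) ?_
      push_cast
      gcongr
    have e3 : (T₃.card : ℝ) ≤ (B ^ 2) ^ k := by
      refine le_trans (b := ((p * N + 1 : ℕ) : ℝ) ^ k) (by exact_mod_cast hT₃) ?_
      push_cast
      gcongr
    have e2 : (T₂.card : ℝ) ≤ B ^ 2 := le_trans (by exact_mod_cast hT₂) hNB
    have e4 : (T₄.card : ℝ) ≤ B ^ 2 := le_trans (by exact_mod_cast hT₄) hNB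
    rw [hT]
    simp only [Finset.card_product, Nat.cast_mul]
    calc (T₁.card : ℝ) * (T₂.card * (T₃.card * T₄.card))
        ≤ (B ^ 2) ^ k * (B ^ 2 * ((B ^ 2) ^ k * B ^ 2)) := by gcongr
      _ = B ^ (4 * k + 4) := by ring_nf
  refine iSup_le fun Q => iSup_le fun hQ => iSup_le fun hQD => iSup_le fun hpos =>
    iSup_le fun hfin => ?_
  have haeD : ∀ᵐ z ∂Q, z ∈ D := mem_ae_iff.2 hQD
  have haem : ∀ u ∈ U, AEStronglyMeasurable (φ u) Q := by
    intro u hu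
    have h1 : AEMeasurable (φ u) (Q.restrict D) :=
      aemeasurable_restrict_of_measurable_subtype hD (hmeas u hu)
    rw [Measure.restrict_eq_self_of_ae_mem haeD] at h1
    exact h1.aestronglyMeasurable
  have hFmem : MemLp F 2 Q := ⟨hF.aestronglyMeasurable, hfin⟩
  have hcover : coveringNumber Q 2 (ENNReal.ofReal ε * eLpNorm F 2 Q) (φ '' U) ≤ T.card := by
    refine coveringNumber_le_card T (fun t f => ∃ u ∈ U, f = φ u ∧
      ∑ j, |u.1 j - t.1 j| ≤ ε / 4 ∧ |u.2.1 - t.2.1| ≤ ε / 4 ∧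
      ∑ j, |u.2.2.1 j - t.2.2.1 j| ≤ ε / 4 ∧ |u.2.2.2 - t.2.2.2| ≤ ε / 4) ?_ ?_ ?_
    · rintro _ ⟨u, hu, rfl⟩
      refine hFmem.mono (haem u hu) ?_
      filter_upwards [haeD] with z hz
      exact (henv u hu z hz).trans (le_abs_self _)
    · rintro _ ⟨u, hu, rfl⟩
      obtain ⟨t₁, ht₁, hd₁⟩ := hc₁ u.1 (hksparse _ (h₁ u hu).1) fun j _ => (h₁ u hu).2 j
      obtain ⟨t₃, ht₃, hd₃⟩ := hc₃ u.2.2.1 (hksparse _ (h₃ u hu).1) fun j _ => (h₃ u hu).2 j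
      obtain ⟨t₂, ht₂, hd₂⟩ := hc₂ u.2.1 (h₂ u hu)
      obtain ⟨t₄, ht₄, hd₄⟩ := hc₄ u.2.2.2 (h₄ u hu)
      exact ⟨(t₁, t₂, t₃, t₄), by simp [hT, ht₁, ht₂, ht₃, ht₄], u, hu, rfl, hd₁.trans hkη,
        hd₂.trans hη4, hd₃.trans hkη, hd₄.trans hη4⟩
    · rintro t - _ - _ - ⟨u, hu, rfl, hu1, hu2, hu3, hu4⟩ ⟨v, hv, rfl, hv1, hv2, hv3, hv4⟩
      have habs : ∀ a b c : ℝ, |a - b| ≤ |a - c| + |b - c| := fun a b c => by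
        rw [abs_sub_comm b c]; exact abs_sub_le a c b
      have hsum : ∀ a b c : Fin p → ℝ, ∑ j, |a j - b j| ≤ ∑ j, |a j - c j| + ∑ j, |b j - c j| :=
        fun a b c => by
          rw [← Finset.sum_add_distrib]
          exact Finset.sum_le_sum fun j _ => habs _ _ _
      -- Two members within `ε / 4` of one label are within `ε / 2` of each other. The spare factor
      -- `2` yields the strict inequality for open balls, as `‖F‖` is positive and finite.
      have hl := hlip v hv u hu (ε / 2) (by positivity)
        ((hsum v.1 u.1 t.1).trans (by linarith)) ((habs _ _ t.2.1).trans (by linarith))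
        ((hsum v.2.2.1 u.2.2.1 t.2.2.1).trans (by linarith))
        ((habs _ _ t.2.2.2).trans (by linarith))
      have hle : eLpNorm (φ v - φ u) 2 Q ≤ ENNReal.ofReal (ε / 2) * eLpNorm F 2 Q := by
        refine eLpNorm_le_mul_eLpNorm_of_ae_le_mul ?_ 2
        filter_upwards [haeD] with z hz
        have h0 := (abs_nonneg _).trans (henv u hu z hz)
        simpa [Real.norm_eq_abs, abs_of_nonneg h0] using hl z hz
      refine hle.trans_lt ?_
      refine ENNReal.mul_lt_mul_left hpos.ne' hfin.ne ?_
      exact (ENNReal.ofReal_lt_ofReal_iff hε).2 (by linarith)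
  have hT' : ((coveringNumber Q 2 (ENNReal.ofReal ε * eLpNorm F 2 Q) (φ '' U) : ℕ∞) : ℝ≥0∞) ≤
      ENNReal.ofReal (B ^ (4 * k + 4)) := by
    refine (ENat.toENNReal_le.2 hcover).trans ?_
    rw [ENat.toENNReal_coe, ← ENNReal.ofReal_natCast]
    exact ENNReal.ofReal_le_ofReal hcard
  refine (ENNReal.log_le_log hT').trans ?_
  rw [ENNReal.log_ofReal_of_pos (by positivity), Real.log_pow]
  refine EReal.coe_le_coe_iff.2 ?_
  have hlog : 0 ≤ Real.log B := Real.log_nonneg hB1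
  have hkC : (k : ℝ) ≤ C * s := le_trans (by exact_mod_cast min_le_left _ _)
    (Nat.floor_le (by positivity))
  refine mul_le_mul_of_nonneg_right ?_ hlog
  push_cast
  nlinarith

end Covering

/-! ### Conditional expectations and envelopes of linear functionals -/

theorem abs_condExp_le_condExp {Ω : Type*} {m m₀ : MeasurableSpace Ω} {P : Measure Ω}
    {f W : Ω → ℝ} (hf : Integrable f P) (hW : Integrable W P) (h : ∀ᵐ z ∂P, |f z| ≤ W z) :
    ∀ᵐ z ∂P, |P[f | m] z| ≤ P[W | m] z := by
  filter_upwards [abs_condExp_ae_le_condExp_abs (m := m) (μ := P) f,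
    condExp_mono (m := m) hf.abs hW h] with z h1 h2
  exact le_trans h1 h2

/-- Conditional Jensen for the convex function `t ^ k` on `[0, ∞)` gives `f ^ k ≤ E[W ^ k | m]`;
integrating removes the conditioning. -/
theorem integral_pow_le_of_le_condExp {Ω : Type*} {m m₀ : MeasurableSpace Ω} (hm : m ≤ m₀)
    {P : Measure Ω} [IsFiniteMeasure P] {f W : Ω → ℝ} (k : ℕ) (hf0 : ∀ z, 0 ≤ f z)
    (hf : Measurable f) (hW0 : ∀ z, 0 ≤ W z) (hW : Integrable W P)
    (hWk : Integrable (fun z => W z ^ k) P) (h : ∀ᵐ z ∂P, f z ≤ P[W | m] z) :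
    Integrable (fun z => f z ^ k) P ∧ ∫ z, f z ^ k ∂P ≤ ∫ z, W z ^ k ∂P := by
  have hJ := (convexOn_pow (𝕜 := ℝ) k).map_condExp_le hm
    (continuous_pow k).continuousOn.lowerSemicontinuousOn (Eventually.of_forall hW0)
    isClosed_Ici hW hWk
  have hle : ∀ᵐ z ∂P, f z ^ k ≤ P[fun z => W z ^ k | m] z := by
    filter_upwards [hJ, h] with z h1 h2
    exact (pow_le_pow_left₀ (hf0 z) h2 k).trans h1
  have hint : Integrable (fun z => f z ^ k) P := by
    refine (integrable_condExp (m := m) (f := fun z => W z ^ k)).mono'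
      (hf.pow_const k).aestronglyMeasurable ?_
    filter_upwards [hle] with z hz
    rwa [Real.norm_of_nonneg (pow_nonneg (hf0 z) k)]
  refine ⟨hint, (integral_mono_ae hint integrable_condExp hle).trans_eq (integral_condExp hm)⟩

section LinearEnvelope

variable {p : ℕ}

theorem measurable_dotProduct_right (b : Fin p → ℝ) : Measurable fun x : Fin p → ℝ => x ⬝ᵥ b := by
  unfold dotProduct
  fun_prop

theorem continuous_dotProduct_left (x : Fin p → ℝ) : Continuous fun b : Fin p → ℝ => x ⬝ᵥ b := by
  unfold dotProduct
  fun_prop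

/-- The vectors at which a family of linear functionals is bounded. -/
def boundedSubmodule (B : Set (Fin p → ℝ)) : Submodule ℝ (Fin p → ℝ) where
  carrier := {x | ∃ M, ∀ b ∈ B, |x ⬝ᵥ b| ≤ M}
  add_mem' := by
    rintro x y ⟨M, hM⟩ ⟨N, hN⟩
    refine ⟨M + N, fun b hb => ?_⟩
    rw [add_dotProduct]
    exact (abs_add_le _ _).trans (add_le_add (hM b hb) (hN b hb))
  zero_mem' := ⟨0, by simp⟩
  smul_mem' := by
    rintro c x ⟨M, hM⟩
    refine ⟨|c| * M, fun b hb => ?_⟩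
    rw [smul_dotProduct, smul_eq_mul, abs_mul]
    exact mul_le_mul_of_nonneg_left (hM b hb) (abs_nonneg c)

/-- If every functional in a family of linear functionals of `X` is almost surely bounded by `V`,
then the family has a finite measurable envelope on the support of `X` that is almost surely
bounded by `V`. -/
theorem exists_linear_envelope {P : Measure (ℝ × (Fin p → ℝ))} (B : Set (Fin p → ℝ))
    {V : ℝ × (Fin p → ℝ) → ℝ} (hV : ∀ᵐ z ∂P, 0 ≤ V z)
    (h : ∀ b ∈ B, ∀ᵐ z ∂P, |z.2 ⬝ᵥ b| ≤ V z) :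
    ∃ G : (Fin p → ℝ) → ℝ, Measurable G ∧ (∀ x, 0 ≤ G x) ∧
      (∀ x ∈ (P.map Prod.snd).support, ∀ b ∈ B, |x ⬝ᵥ b| ≤ G x) ∧ ∀ᵐ z ∂P, G z.2 ≤ V z := by
  obtain ⟨B₀, hB₀, hcount, hdense⟩ :=
    (TopologicalSpace.IsSeparable.of_separableSpace B).exists_countable_dense_subset
  have : Countable B₀ := hcount.to_subtype
  let E : (Fin p → ℝ) → ℝ≥0∞ := fun x => ⨆ b : B₀, ENNReal.ofReal |x ⬝ᵥ (b : Fin p → ℝ)|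
  have hE : Measurable E := Measurable.iSup fun b =>
    ((measurable_dotProduct_right (b : Fin p → ℝ)).abs).ennreal_ofReal
  have hae : ∀ᵐ z ∂P, 0 ≤ V z ∧ ∀ b ∈ B₀, |z.2 ⬝ᵥ b| ≤ V z := by
    filter_upwards [hV, (ae_ball_iff hcount).2 fun b hb => h b (hB₀ hb)] with z h1 h2
    exact ⟨h1, h2⟩
  -- A linear subspace of a finite-dimensional space is closed. This one contains `X` almost surely,
  -- hence it contains the whole support: the countable supremum is finite at every point of the
  -- support, not only almost everywhere.
  have hclosed : IsClosed (boundedSubmodule B₀ : Set (Fin p → ℝ)) :=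
    (boundedSubmodule B₀).closed_of_finiteDimensional
  have hsupp : (P.map Prod.snd).support ⊆ boundedSubmodule B₀ := by
    refine Measure.support_subset_of_isClosed hclosed ?_
    refine (ae_map_iff (p := fun x => x ∈ (boundedSubmodule B₀ : Set (Fin p → ℝ)))
      measurable_snd.aemeasurable hclosed.measurableSet).2 ?_
    filter_upwards [hae] with z hz
    exact ⟨V z, hz.2⟩
  refine ⟨fun x => (E x).toReal, hE.ennreal_toReal, fun x => ENNReal.toReal_nonneg, ?_, ?_⟩
  · intro x hx b hb
    obtain ⟨M, hM⟩ := hsupp hx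
    have hfin : E x ≠ ⊤ := by
      refine ne_top_of_le_ne_top (ENNReal.ofReal_ne_top (r := M)) (iSup_le fun b => ?_)
      exact ENNReal.ofReal_le_ofReal (hM b b.2)
    have hB₀le : B₀ ⊆ {b | |x ⬝ᵥ b| ≤ (E x).toReal} := fun b hb =>
      (ENNReal.ofReal_le_iff_le_toReal hfin).1
        (le_iSup (fun b : B₀ => ENNReal.ofReal |x ⬝ᵥ (b : Fin p → ℝ)|) ⟨b, hb⟩)
    have hcl : IsClosed {b | |x ⬝ᵥ b| ≤ (E x).toReal} :=
      isClosed_le (continuous_dotProduct_left x).abs continuous_const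
    exact closure_minimal hB₀le hcl (hdense hb)
  · filter_upwards [hae] with z hz
    refine ENNReal.toReal_le_of_le_ofReal hz.1 (iSup_le fun b => ?_)
    exact ENNReal.ofReal_le_ofReal (hz.2 b b.2)

/-- The almost sure bound is taken to be `E[W | X]`, whose moments are controlled by those of `W`
whatever the dimension and the size of the coefficients. -/
theorem exists_linear_envelope_of_condExp {P : Measure (ℝ × (Fin p → ℝ))} [IsProbabilityMeasure P]
    (B : Set (Fin p → ℝ)) {W : ℝ × (Fin p → ℝ) → ℝ} (k : ℕ) (hW0 : ∀ z, 0 ≤ W z)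
    (hW : Integrable W P) (hWk : Integrable (fun z => W z ^ k) P)
    (h : ∀ b ∈ B, ∀ᵐ z ∂P, |z.2 ⬝ᵥ b| ≤ P[W | ModelData.σX p] z) :
    ∃ G : (Fin p → ℝ) → ℝ, Measurable G ∧ (∀ x, 0 ≤ G x) ∧
      (∀ x ∈ (P.map Prod.snd).support, ∀ b ∈ B, |x ⬝ᵥ b| ≤ G x) ∧
      Integrable (fun z => G z.2 ^ k) P ∧ ∫ z, G z.2 ^ k ∂P ≤ ∫ z, W z ^ k ∂P := by
  obtain ⟨G, hG, hG0, hGB, hGle⟩ := exists_linear_envelope B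
    (condExp_nonneg (m := ModelData.σX p) (Eventually.of_forall hW0)) h
  exact ⟨G, hG, hG0, hGB, integral_pow_le_of_le_condExp measurable_snd.comap_le k
    (fun z => hG0 z.2) (hG.comp measurable_snd) hW0 hW hWk hGle⟩

end LinearEnvelope

/-- A derivative at an accumulation point is a limit of slopes, and in all other cases `derivWithin`
is `0`. No differentiability is needed, so increments of `σ²_θ` suffice to bound its derivative. -/
theorem abs_derivWithin_le_of_lipschitz {f : ℝ → ℝ} {s : Set ℝ} {x L : ℝ} (hL : 0 ≤ L)
    (h : ∀ t ∈ s, |f t - f x| ≤ L * |t - x|) : |derivWithin f s x| ≤ L := by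
  by_cases hd : DifferentiableWithinAt ℝ f s x
  · by_cases hx : AccPt x (𝓟 s)
    · have ht := (hasDerivWithinAt_iff_tendsto_slope.1 hd.hasDerivWithinAt).abs
      rw [accPt_principal_iff_nhdsWithin] at hx
      refine le_of_tendsto ht ?_
      filter_upwards [self_mem_nhdsWithin] with t hts
      rw [slope_def_field, abs_div]
      exact div_le_of_le_mul₀ (abs_nonneg _) hL (h t hts.1)
    · rw [derivWithin_zero_of_not_accPt hx]
      simpa
  · rw [derivWithin_zero_of_not_differentiableWithinAt hd]
    simpa

namespace ModelData

/-! ### Consequences of the model assumptions -/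

variable {p : ℕ} {m : ModelData p}

theorem measurableSet_domain (hm : m.IsModel) : MeasurableSet m.domain :=
  hm.measurableSet_𝒴.prod Measure.isClosed_support.measurableSet

theorem ae_mem_𝒳 : ∀ᵐ z ∂m.P, z.2 ∈ m.𝒳 :=
  ae_of_ae_map (p := fun x => x ∈ (m.P.map Prod.snd).support) measurable_snd.aemeasurable
    Measure.support_mem_ae

theorem aestronglyMeasurable_comp_fst (hm : m.IsModel) {f : ℝ → ℝ}
    (hf : Measurable (m.𝒴.domRestrict f)) : AEStronglyMeasurable (fun z => f z.1) m.P := by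
  have hS : MeasurableSet (Prod.fst ⁻¹' m.𝒴 : Set (ℝ × (Fin p → ℝ))) :=
    measurable_fst hm.measurableSet_𝒴
  have h1 : AEMeasurable (fun z : ℝ × (Fin p → ℝ) => f z.1) (m.P.restrict (Prod.fst ⁻¹' m.𝒴)) := by
    refine aemeasurable_restrict_of_measurable_subtype hS ?_
    exact hf.comp ((measurable_fst.comp measurable_subtype_coe).subtype_mk (h := fun z => z.2))
  rw [Measure.restrict_eq_self_of_ae_mem (s := Prod.fst ⁻¹' m.𝒴) hm.mem_𝒴] at h1
  exact h1.aestronglyMeasurable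

theorem integrable_comp_fst (hm : m.IsModel) {f F : ℝ → ℝ}
    (hf : Measurable (m.𝒴.domRestrict f)) (hF : Integrable (fun z => F z.1) m.P)
    (hle : ∀ y ∈ m.𝒴, |f y| ≤ F y) : Integrable (fun z => f z.1) m.P := by
  refine hF.mono' (aestronglyMeasurable_comp_fst hm hf) ?_
  filter_upwards [hm.mem_𝒴] with z hz
  exact hle _ hz

theorem hasDerivWithinAt_dotProduct_β (hm : m.IsModel) {θ : ℝ} (hθ : θ ∈ m.Θ) (x : Fin p → ℝ) :
    HasDerivWithinAt (fun t => x ⬝ᵥ m.β t) (x ⬝ᵥ m.βdot θ) m.Θ θ := by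
  have h := hasDerivWithinAt_pi.1 (hm.diff_β θ hθ).hasDerivWithinAt
  unfold dotProduct
  exact HasDerivWithinAt.fun_sum fun j _ => (h j).const_mul (x j)

theorem abs_Λ_sub_le (hm : m.IsModel) (hΘ : m.Θ.OrdConnected) {Fdot : ℝ → ℝ}
    (hFdot : IsEnvelope m.𝒴 (m.Λdot '' m.Θ) Fdot) {y : ℝ} (hy : y ∈ m.𝒴) {t θ : ℝ}
    (ht : t ∈ m.Θ) (hθ : θ ∈ m.Θ) : |m.Λ t y - m.Λ θ y| ≤ Fdot y * |t - θ| :=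
  hΘ.convex.norm_image_sub_le_of_norm_derivWithin_le (hm.diff_θ y hy)
    (fun _ hr => hFdot _ (mem_image_of_mem _ hr) y hy) hθ ht

/-- On an interval the mean value theorem bounds `Λ_t - Λ_θ` by `Fdot * |t - θ|`. Conditioning on
`X` bounds the difference quotients of `Xβ_t` by `E[Fdot | X]`, and the bound passes to the limit,
with no interchange of derivative and expectation. Otherwise the interchange is assumed and
`Xβdot_θ` is itself a conditional expectation. -/
theorem abs_dotProduct_βdot_le_condExp (hm : m.IsModel) {F Fdot : ℝ → ℝ}
    (hmeas : ∀ θ ∈ m.Θ, Measurable (m.𝒴.domRestrict (m.Λ θ)) ∧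
      Measurable (m.𝒴.domRestrict (m.Λdot θ)))
    (hF : IsEnvelope m.𝒴 (m.Λ '' m.Θ) F) (hFdot : IsEnvelope m.𝒴 (m.Λdot '' m.Θ) Fdot)
    (hFi : Integrable (fun z => F z.1) m.P) (hFdoti : Integrable (fun z => Fdot z.1) m.P)
    {θ : ℝ} (hθ : θ ∈ m.Θ) :
    ∀ᵐ z ∂m.P, |z.2 ⬝ᵥ m.βdot θ| ≤ m.P[fun z => Fdot z.1 | σX p] z := by
  have hint : ∀ t ∈ m.Θ, Integrable (fun z => m.Λ t z.1) m.P := fun t ht =>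
    integrable_comp_fst hm (hmeas t ht).1 hFi fun y hy => hF _ (mem_image_of_mem _ ht) y hy
  rcases hm.regular with hΘ | hΘ
  · have hacc := uniqueDiffWithinAt_iff_accPt.1 (hm.uniqueDiff_Θ θ hθ)
    rw [accPt_principal_iff_nhdsWithin] at hacc
    -- A sequence is used so that the exceptional null sets, one for each `t k`, have a null union.
    obtain ⟨t, ht⟩ := exists_seq_tendsto (𝓝[m.Θ \ {θ}] θ)
    obtain ⟨N, hN⟩ := eventually_atTop.1 (ht.eventually self_mem_nhdsWithin)
    have hstep : ∀ᵐ z ∂m.P, ∀ k, N ≤ k →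
        |z.2 ⬝ᵥ m.β (t k) - z.2 ⬝ᵥ m.β θ| ≤ |t k - θ| * m.P[fun z => Fdot z.1 | σX p] z := by
      refine ae_all_iff.2 fun k => ?_
      by_cases hk : N ≤ k
      · have htk := (hN k hk).1
        have h1 := abs_condExp_le_condExp (m := σX p) ((hint _ htk).sub (hint θ hθ))
          (hFdoti.const_mul |t k - θ|) (by
            filter_upwards [hm.mem_𝒴] with z hz
            rw [mul_comm]
            exact abs_Λ_sub_le hm hΘ hFdot hz htk hθ)
        filter_upwards [h1, condExp_sub (hint _ htk) (hint θ hθ) (σX p),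
          condExp_smul (μ := m.P) |t k - θ| (fun z => Fdot z.1) (σX p),
          hm.regression _ htk, hm.regression θ hθ] with z e1 e2 e3 e4 e5 _
        have e3' : m.P[fun z => |t k - θ| * Fdot z.1 | σX p] z =
          |t k - θ| * m.P[fun z => Fdot z.1 | σX p] z := e3
        rwa [e2, e3', Pi.sub_apply, e4, e5] at e1
      · exact Eventually.of_forall fun z h => absurd h hk
    filter_upwards [hstep] with z hz
    have hs := (hasDerivWithinAt_iff_tendsto_slope.1
      (hasDerivWithinAt_dotProduct_β hm hθ z.2)).abs.comp ht
    refine le_of_tendsto hs ?_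
    filter_upwards [eventually_ge_atTop N] with k hk
    have hne : 0 < |t k - θ| := abs_pos.2 (sub_ne_zero.2 (hN k hk).2)
    simp only [Function.comp, slope_def_field, abs_div]
    rw [div_le_iff₀ hne, mul_comm]
    exact hz k hk
  · filter_upwards [(hΘ θ hθ).1, abs_condExp_le_condExp (m := σX p)
      (integrable_comp_fst hm (hmeas θ hθ).2 hFdoti fun y hy =>
        hFdot _ (mem_image_of_mem _ hθ) y hy) hFdoti (by
        filter_upwards [hm.mem_𝒴] with z hz
        exact hFdot _ (mem_image_of_mem _ hθ) _ hz)] with z h1 h2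
    rwa [h1] at h2

/-- Envelopes of the linear predictors `x β_θ` and of their derivatives in `θ`. -/
theorem exists_linear_envelopes (hm : m.IsModel) {F Fdot : ℝ → ℝ}
    (hmeas : ∀ θ ∈ m.Θ, Measurable (m.𝒴.domRestrict (m.Λ θ)) ∧
      Measurable (m.𝒴.domRestrict (m.Λdot θ)))
    (hF0 : ∀ y, 0 ≤ F y) (hFdot0 : ∀ y, 0 ≤ Fdot y)
    (hF : IsEnvelope m.𝒴 (m.Λ '' m.Θ) F) (hFdot : IsEnvelope m.𝒴 (m.Λdot '' m.Θ) Fdot)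
    (hFi : Integrable (fun z => F z.1) m.P) (hFdoti : Integrable (fun z => Fdot z.1) m.P) (k : ℕ)
    (hFk : Integrable (fun z => F z.1 ^ k) m.P)
    (hFdotk : Integrable (fun z => Fdot z.1 ^ k) m.P) :
    ∃ G Gdot : (Fin p → ℝ) → ℝ, Measurable G ∧ Measurable Gdot ∧ (∀ x, 0 ≤ G x) ∧
      (∀ x, 0 ≤ Gdot x) ∧ (∀ x ∈ m.𝒳, ∀ θ ∈ m.Θ, |x ⬝ᵥ m.β θ| ≤ G x) ∧
      (∀ x ∈ m.𝒳, ∀ θ ∈ m.Θ, |x ⬝ᵥ m.βdot θ| ≤ Gdot x) ∧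
      Integrable (fun z => G z.2 ^ k) m.P ∧ Integrable (fun z => Gdot z.2 ^ k) m.P ∧
      ∫ z, G z.2 ^ k ∂m.P ≤ ∫ z, F z.1 ^ k ∂m.P ∧
      ∫ z, Gdot z.2 ^ k ∂m.P ≤ ∫ z, Fdot z.1 ^ k ∂m.P := by
  have := hm.prob
  obtain ⟨G, h1, h2, h3, h4, h5⟩ := exists_linear_envelope_of_condExp (P := m.P) (m.β '' m.Θ)
    (W := fun z => F z.1) k (fun z => hF0 z.1) hFi hFk (by
      rintro _ ⟨θ, hθ, rfl⟩
      filter_upwards [hm.regression θ hθ, abs_condExp_le_condExp (m := σX p)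
        (integrable_comp_fst hm (hmeas θ hθ).1 hFi fun y hy =>
          hF _ (mem_image_of_mem _ hθ) y hy) hFi (by
          filter_upwards [hm.mem_𝒴] with z hz
          exact hF _ (mem_image_of_mem _ hθ) _ hz)] with z e1 e2
      rwa [e1] at e2)
  obtain ⟨Gdot, i1, i2, i3, i4, i5⟩ := exists_linear_envelope_of_condExp (P := m.P)
    (m.βdot '' m.Θ) (W := fun z => Fdot z.1) k (fun z => hFdot0 z.1) hFdoti hFdotk (by
      rintro _ ⟨θ, hθ, rfl⟩
      exact abs_dotProduct_βdot_le_condExp hm hmeas hF hFdot hFi hFdoti hθ)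
  exact ⟨G, Gdot, h1, i1, h2, i2, fun x hx θ hθ => h3 x hx _ (mem_image_of_mem _ hθ),
    fun x hx θ hθ => i3 x hx _ (mem_image_of_mem _ hθ), h4, i4, h5, i5⟩

theorem σsq_eq_integral (hm : m.IsModel) {θ : ℝ} (hθ : θ ∈ m.Θ) :
    m.σsq θ = ∫ z, m.err θ z ^ 2 ∂m.P := by
  have := hm.prob
  rw [← integral_condExp (measurable_snd.comap_le : σX p ≤ _), integral_congr_ae (hm.condVar θ hθ)]
  simp

/-- Bounds for the errors, their derivatives and their increments give a bound for the derivative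
of the error variance. -/
theorem abs_σsqdot_le (hm : m.IsModel) {F Fdot : ℝ → ℝ} {G Gdot : (Fin p → ℝ) → ℝ}
    {W : ℝ × (Fin p → ℝ) → ℝ}
    (hmeas : ∀ θ ∈ m.Θ, Measurable (m.𝒴.domRestrict (m.Λ θ)))
    (hF : IsEnvelope m.𝒴 (m.Λ '' m.Θ) F) (hFdot : IsEnvelope m.𝒴 (m.Λdot '' m.Θ) Fdot)
    (hG : ∀ x ∈ m.𝒳, ∀ θ ∈ m.Θ, |x ⬝ᵥ m.β θ| ≤ G x)
    (hGdot : ∀ x ∈ m.𝒳, ∀ θ ∈ m.Θ, |x ⬝ᵥ m.βdot θ| ≤ Gdot x)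
    (hW : ∀ z, F z.1 + G z.2 ≤ W z) (hWdot : ∀ z, Fdot z.1 + Gdot z.2 ≤ W z)
    (hWi : Integrable (fun z => W z ^ 2) m.P) {θ : ℝ} (hθ : θ ∈ m.Θ) :
    |m.σsqdot θ| ≤ 2 * ∫ z, W z ^ 2 ∂m.P := by
  have herr : ∀ z, z.1 ∈ m.𝒴 → z.2 ∈ m.𝒳 → ∀ t ∈ m.Θ, |m.err t z| ≤ W z := fun z h1 h2 t ht =>
    (abs_sub _ _).trans ((add_le_add (hF _ (mem_image_of_mem _ ht) _ h1) (hG _ h2 t ht)).trans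
      (hW z))
  have hI : 0 ≤ ∫ z, W z ^ 2 ∂m.P := integral_nonneg fun z => sq_nonneg _
  rcases hm.regular with hΘ | hΘ
  -- The variance is Lipschitz in `θ`: the increment of `err ^ 2` factors into a sum bounded by `2 *
  -- W` and a difference bounded by `W * |t - θ|`.
  · refine abs_derivWithin_le_of_lipschitz (by positivity) fun t ht => ?_
    have hint : ∀ t ∈ m.Θ, Integrable (fun z => m.err t z ^ 2) m.P := by
      intro t ht
      refine hWi.mono' (((aestronglyMeasurable_comp_fst hm (hmeas t ht)).sub
        ((measurable_dotProduct_right _).comp measurable_snd).aestronglyMeasurable).pow 2) ?_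
      filter_upwards [hm.mem_𝒴, ae_mem_𝒳] with z h1 h2
      rw [Real.norm_eq_abs, abs_pow]
      exact pow_le_pow_left₀ (abs_nonneg _) (herr z h1 h2 t ht) 2
    rw [σsq_eq_integral hm ht, σsq_eq_integral hm hθ, ← integral_sub (hint t ht) (hint θ hθ),
      mul_assoc, mul_comm, mul_assoc, ← integral_mul_const, ← Real.norm_eq_abs]
    refine norm_integral_le_of_norm_le (hWi.mul_const _) ?_
    filter_upwards [hm.mem_𝒴, ae_mem_𝒳] with z h1 h2
    have hβ : |z.2 ⬝ᵥ m.β t - z.2 ⬝ᵥ m.β θ| ≤ Gdot z.2 * |t - θ| :=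
      hΘ.convex.norm_image_sub_le_of_norm_hasDerivWithin_le
        (fun r hr => hasDerivWithinAt_dotProduct_β hm hr z.2) (fun r hr => hGdot _ h2 r hr) hθ ht
    have hΛ := abs_Λ_sub_le hm hΘ hFdot h1 ht hθ
    have hdiff : |m.err t z - m.err θ z| ≤ W z * |t - θ| := by
      have : m.err t z - m.err θ z =
          (m.Λ t z.1 - m.Λ θ z.1) - (z.2 ⬝ᵥ m.β t - z.2 ⬝ᵥ m.β θ) := by
        unfold err; ring
      rw [this]
      refine (abs_sub _ _).trans ((add_le_add hΛ hβ).trans ?_)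
      rw [← add_mul]
      exact mul_le_mul_of_nonneg_right (hWdot z) (abs_nonneg _)
    have hsum : |m.err t z + m.err θ z| ≤ 2 * W z :=
      (abs_add_le _ _).trans (by linarith [herr z h1 h2 t ht, herr z h1 h2 θ hθ])
    rw [Real.norm_eq_abs, sq_sub_sq, abs_mul]
    have := mul_le_mul hsum hdiff (abs_nonneg _) ((abs_nonneg _).trans hsum)
    linarith
  · unfold σsqdot
    rw [(hΘ θ hθ).2.derivWithin (hm.uniqueDiff_Θ θ hθ), abs_mul, abs_two]
    refine mul_le_mul_of_nonneg_left ?_ zero_le_two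
    rw [← Real.norm_eq_abs]
    refine norm_integral_le_of_norm_le hWi ?_
    filter_upwards [hm.mem_𝒴, ae_mem_𝒳] with z h1 h2
    have hdot : |m.errdot θ z| ≤ W z :=
      (abs_sub _ _).trans ((add_le_add (hFdot _ (mem_image_of_mem _ hθ) _ h1)
        (hGdot _ h2 θ hθ)).trans (hWdot z))
    have he := herr z h1 h2 θ hθ
    rw [Real.norm_eq_abs, abs_mul, sq]
    exact mul_le_mul he hdot (abs_nonneg _) ((abs_nonneg _).trans he)

end ModelData

/-! ### Bounds for the score as a polynomial -/

theorem abs_mul_sub_mul_le {x x' y y' X Y dX dY : ℝ} (hx : |x| ≤ X) (hy : |y'| ≤ Y)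
    (hdx : |x - x'| ≤ dX) (hdy : |y - y'| ≤ dY) : |x * y - x' * y'| ≤ X * dY + dX * Y := by
  rw [show x * y - x' * y' = x * (y - y') + (x - x') * y' by ring]
  refine (abs_add_le _ _).trans (add_le_add ?_ ?_)
  · rw [abs_mul]
    exact mul_le_mul hx hdy (abs_nonneg _) ((abs_nonneg _).trans hx)
  · rw [abs_mul]
    exact mul_le_mul hdx hy (abs_nonneg _) ((abs_nonneg _).trans hdx)

theorem abs_mul_le_of_le {x y X Y : ℝ} (hx : |x| ≤ X) (hy : |y| ≤ Y) : |x * y| ≤ X * Y := by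
  rw [abs_mul]
  exact mul_le_mul hx hy (abs_nonneg _) ((abs_nonneg _).trans hx)

/-- Here `a = 1/h₂`, `b = h₄`, and `P`, `Q` are the two residuals. The constant `7` is larger than
needed, so that it also serves the increments below. -/
theorem abs_score_polynomial_le {E w a b P Q : ℝ} (hE : 1 ≤ E) (hw : 1 ≤ w) (ha : |a| ≤ E)
    (hb : |b| ≤ E) (hP : |P| ≤ E * w) (hQ : |Q| ≤ E * w) :
    |-(a * b / 2) - a * P * Q + b * (a * P * (a * P)) / 2| ≤ 7 * E ^ 5 * w ^ 2 := by
  have h1 := abs_mul_le_of_le ha hb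
  have h2 := abs_mul_le_of_le ha hP
  have h3 := abs_mul_le_of_le h2 hQ
  have h4 := abs_mul_le_of_le hb (abs_mul_le_of_le h2 h2)
  have e2 : E * E ≤ E ^ 5 * w ^ 2 := by
    rw [← sq, ← mul_one (E ^ 2)]
    exact mul_le_mul (pow_le_pow_right₀ hE (by norm_num)) (one_le_pow₀ hw) zero_le_one (by positivity)
  have e3 : E * (E * w) * (E * w) ≤ E ^ 5 * w ^ 2 := by
    rw [show E * (E * w) * (E * w) = E ^ 3 * w ^ 2 by ring]
    gcongr
    norm_num
  have e5 : E * (E * (E * w) * (E * (E * w))) = E ^ 5 * w ^ 2 := by ring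
  rw [e5] at h4
  have h0 : 0 ≤ E ^ 5 * w ^ 2 := by positivity
  rw [abs_le] at *
  constructor <;> linarith [h1.1, h1.2, h3.1, h3.2, h4.1, h4.2]

/-- The product rule for increments, applied factor by factor: the three terms contribute at most
`2/2`, `3` and `5/2` times `η * E ^ 5 * w ^ 2`, in total less than `7`. -/
theorem abs_score_polynomial_sub_le {E w η a b P Q a' b' P' Q' : ℝ} (hE : 1 ≤ E) (hw : 1 ≤ w)
    (hη : 0 ≤ η) (ha : |a| ≤ E) (hb : |b| ≤ E) (hP : |P| ≤ E * w)
    (ha' : |a'| ≤ E) (hb' : |b'| ≤ E) (hP' : |P'| ≤ E * w) (hQ' : |Q'| ≤ E * w)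
    (hda : |a - a'| ≤ E * η) (hdb : |b - b'| ≤ E * η)
    (hdP : |P - P'| ≤ E * η * w) (hdQ : |Q - Q'| ≤ E * η * w) :
    |(-(a * b / 2) - a * P * Q + b * (a * P * (a * P)) / 2) -
      (-(a' * b' / 2) - a' * P' * Q' + b' * (a' * P' * (a' * P')) / 2)| ≤
        η * (7 * E ^ 5 * w ^ 2) := by
  have h1 := abs_mul_sub_mul_le ha hb' hda hdb
  have h2 := abs_mul_sub_mul_le ha hP' hda hdP
  have h3 := abs_mul_sub_mul_le (abs_mul_le_of_le ha hP) hQ' h2 hdQ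
  have h4 := abs_mul_sub_mul_le (abs_mul_le_of_le ha hP) (abs_mul_le_of_le ha' hP') h2 h2
  have h5 := abs_mul_sub_mul_le hb
    (abs_mul_le_of_le (abs_mul_le_of_le ha' hP') (abs_mul_le_of_le ha' hP')) hdb h4
  have e2 : η * (E * E) ≤ η * (E ^ 5 * w ^ 2) := by
    refine mul_le_mul_of_nonneg_left ?_ hη
    rw [← sq, ← mul_one (E ^ 2)]
    exact mul_le_mul (pow_le_pow_right₀ hE (by norm_num)) (one_le_pow₀ hw) zero_le_one (by positivity)
  have e3 : η * (E ^ 3 * w ^ 2) ≤ η * (E ^ 5 * w ^ 2) := by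
    gcongr
    norm_num
  have h0 : 0 ≤ η * (E ^ 5 * w ^ 2) := by positivity
  have f1 : E * (E * η) + E * η * E = 2 * (η * (E * E)) := by ring
  have f3 : E * (E * w) * (E * η * w) + (E * (E * η * w) + E * η * (E * w)) * (E * w) =
    3 * (η * (E ^ 3 * w ^ 2)) := by ring
  have f5 : E * (E * (E * w) * (E * (E * η * w) + E * η * (E * w)) +
      (E * (E * η * w) + E * η * (E * w)) * (E * (E * w))) +
      E * η * (E * (E * w) * (E * (E * w))) = 5 * (η * (E ^ 5 * w ^ 2)) := by ring
  rw [f1] at h1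
  rw [f3] at h3
  rw [f5] at h5
  clear h2 h4 f1 f3 f5 ha hb hP ha' hb' hP' hQ' hda hdb hdP hdQ
  rw [abs_le] at *
  constructor <;> linarith [h1.1, h1.2, h3.1, h3.2, h5.1, h5.2]

theorem abs_dotProduct_le {p : ℕ} {K : ℝ} {x : Fin p → ℝ} (hx : ∀ j, |x j| ≤ K) (u : Fin p → ℝ) :
    |x ⬝ᵥ u| ≤ |K| * ∑ j, |u j| := by
  rw [Finset.mul_sum]
  refine (Finset.abs_sum_le_sum_abs _ _).trans (Finset.sum_le_sum fun j _ => ?_)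
  rw [abs_mul]
  exact mul_le_mul_of_nonneg_right ((hx j).trans (le_abs_self K)) (abs_nonneg _)

namespace ModelData

variable {p : ℕ} {m : ModelData p}

/-! ### The score class as a parametrized class -/

variable (m) in
/-- The score with linear nuisance functions given by their coefficients. -/
noncomputable def scoreParam (θ : ℝ) (u : (Fin p → ℝ) × ℝ × (Fin p → ℝ) × ℝ) :
    ℝ × (Fin p → ℝ) → ℝ :=
  m.score θ (fun x => x ⬝ᵥ u.1, u.2.1, fun x => x ⬝ᵥ u.2.2.1, u.2.2.2)

variable (m) in
/-- The coefficients of the members of the nuisance realization set at `θ`. -/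
def paramSet (n s : ℕ) (C θ : ℝ) : Set ((Fin p → ℝ) × ℝ × (Fin p → ℝ) × ℝ) :=
  {u | ((fun x => x ⬝ᵥ u.1, u.2.1, fun x => x ⬝ᵥ u.2.2.1, u.2.2.2) :
    ((Fin p → ℝ) → ℝ) × ℝ × ((Fin p → ℝ) → ℝ) × ℝ) ∈ m.realizationsAt n s C θ}

theorem scoreClass_eq_image {n s : ℕ} {C θ : ℝ} (hθ : θ ∈ m.Θ) :
    m.scoreClass n s C θ = m.scoreParam θ '' m.paramSet n s C θ := by
  ext f
  constructor
  · rintro ⟨h, hh, rfl⟩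
    have hh' := hh
    obtain ⟨h₁, ⟨β₁, hβ₁⟩, h₂, -, h₃, ⟨β₃, hβ₃⟩, h₄, -, rfl⟩ := hh
    have e1 : h₁ θ = fun x => x ⬝ᵥ β₁ θ := funext (hβ₁ θ hθ).1
    have e3 : h₃ θ = fun x => x ⬝ᵥ β₃ θ := funext (hβ₃ θ hθ).1
    rw [e1, e3] at hh' ⊢
    exact ⟨(β₁ θ, h₂ θ, β₃ θ, h₄ θ), hh', rfl⟩
  · rintro ⟨u, hu, rfl⟩
    exact ⟨_, hu, rfl⟩

/-- A linear functional determines its coefficients, by evaluation at the unit vectors, so the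
constraints on a representing family at `θ` are constraints on `u` itself. -/
theorem paramSet_bounds {n s : ℕ} {C θ : ℝ} (hθ : θ ∈ m.Θ)
    {u : (Fin p → ℝ) × ℝ × (Fin p → ℝ) × ℝ} (hu : u ∈ m.paramSet n s C θ) :
    ((hammingNorm u.1 : ℝ) ≤ C * s ∧ ∑ j, |u.1 j - m.β θ j| ≤ C * (n : ℝ) ^ (-(1 / 4) : ℝ)) ∧
    |u.2.1 - m.σsq θ| ≤ C * (n : ℝ) ^ (-(1 / 4) : ℝ) ∧
    ((hammingNorm u.2.2.1 : ℝ) ≤ C * s ∧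
      ∑ j, |u.2.2.1 j - m.βdot θ j| ≤ C * (n : ℝ) ^ (-(1 / 4) : ℝ)) ∧
    |u.2.2.2 - m.σsqdot θ| ≤ C * (n : ℝ) ^ (-(1 / 4) : ℝ) := by
  obtain ⟨h₁, ⟨β₁, hβ₁⟩, h₂, hh₂, h₃, ⟨β₃, hβ₃⟩, h₄, hh₄, he⟩ := hu
  simp only [Prod.mk.injEq] at he
  obtain ⟨e1, e2, e3, e4⟩ := he
  have hcoef : ∀ u v : Fin p → ℝ, (∀ x : Fin p → ℝ, x ⬝ᵥ u = x ⬝ᵥ v) → u = v := by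
    intro u v h
    funext j
    simpa using h (Pi.single j 1)
  have f1 : u.1 = β₁ θ := hcoef _ _ fun x => (congrFun e1 x).trans ((hβ₁ θ hθ).1 x)
  have f3 : u.2.2.1 = β₃ θ := hcoef _ _ fun x => (congrFun e3 x).trans ((hβ₃ θ hθ).1 x)
  rw [f1, f3, e2, e4]
  exact ⟨(hβ₁ θ hθ).2, (hh₂ θ hθ).2, (hβ₃ θ hθ).2, hh₄ θ hθ⟩

/-- Up to `c_θ`, the score is a polynomial in `h₂⁻¹`, `h₄` and the residuals; the grouping is that
of the polynomial bounds above. -/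
theorem scoreParam_eq (θ : ℝ) (u : (Fin p → ℝ) × ℝ × (Fin p → ℝ) × ℝ) (z : ℝ × (Fin p → ℝ)) :
    m.scoreParam θ u z =
      -((u.2.1)⁻¹ * u.2.2.2 / 2)
      - (u.2.1)⁻¹ * (m.Λ θ z.1 - z.2 ⬝ᵥ u.1) * (m.Λdot θ z.1 - z.2 ⬝ᵥ u.2.2.1)
      + u.2.2.2 * ((u.2.1)⁻¹ * (m.Λ θ z.1 - z.2 ⬝ᵥ u.1) *
          ((u.2.1)⁻¹ * (m.Λ θ z.1 - z.2 ⬝ᵥ u.1))) / 2 + m.cfun θ z.1 := by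
  simp only [scoreParam, score, div_eq_mul_inv, mul_inv]
  ring

theorem measurable_domRestrict_comp_fst {f : ℝ → ℝ} (hf : Measurable (m.𝒴.domRestrict f)) :
    Measurable fun z : m.domain => f z.1.1 :=
  hf.comp ((measurable_fst.comp measurable_subtype_coe).subtype_mk (h := fun z => z.2.1))

theorem measurable_scoreParam {θ : ℝ} (h1 : Measurable (m.𝒴.domRestrict (m.Λ θ)))
    (h2 : Measurable (m.𝒴.domRestrict (m.Λdot θ)))
    (h3 : Measurable (m.𝒴.domRestrict (m.Λprime θ)))
    (h4 : Measurable (m.𝒴.domRestrict (m.Λdotprime θ)))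
    (u : (Fin p → ℝ) × ℝ × (Fin p → ℝ) × ℝ) :
    Measurable (m.domain.domRestrict (m.scoreParam θ u)) := by
  have hx : ∀ v : Fin p → ℝ, Measurable fun z : m.domain => z.1.2 ⬝ᵥ v := fun v =>
    (measurable_dotProduct_right v).comp (measurable_snd.comp measurable_subtype_coe)
  have hA := (measurable_domRestrict_comp_fst h1).sub (hx u.1)
  have hB := (measurable_domRestrict_comp_fst h2).sub (hx u.2.2.1)
  have hc := (measurable_domRestrict_comp_fst h4).div (measurable_domRestrict_comp_fst h3)
  exact (((measurable_const.sub ((hA.const_mul _).mul hB)).add ((hA.pow_const 2).const_mul _)).add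
    hc)

/-- The parameters lie in a separable metric space, and at each point `z` the score is continuous in
them where `h₂ ≠ 0`; a countable dense set of parameters gives the subclass. -/
theorem isPointwiseMeasurable_scoreClass {n s : ℕ} {C θ : ℝ} (hθ : θ ∈ m.Θ)
    (hmeas : ∀ u, Measurable (m.domain.domRestrict (m.scoreParam θ u)))
    (hne : ∀ u ∈ m.paramSet n s C θ, u.2.1 ≠ 0) :
    IsPointwiseMeasurable m.domain (m.scoreClass n s C θ) := by
  rw [scoreClass_eq_image hθ]
  refine ⟨by rintro _ ⟨u, -, rfl⟩; exact hmeas u, ?_⟩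
  obtain ⟨U₀, hU₀, hcount, hdense⟩ := (TopologicalSpace.IsSeparable.of_separableSpace
    (m.paramSet n s C θ)).exists_countable_dense_subset
  refine ⟨m.scoreParam θ '' U₀, image_mono hU₀, hcount.image _, ?_⟩
  rintro _ ⟨u, hu, rfl⟩
  obtain ⟨v, hv, hlim⟩ := mem_closure_iff_seq_limit.1 (hdense hu)
  refine ⟨fun k => m.scoreParam θ (v k), fun k => mem_image_of_mem _ (hv k), fun z _ => ?_⟩
  have hinv : ContinuousAt (fun u : (Fin p → ℝ) × ℝ × (Fin p → ℝ) × ℝ => (u.2.1)⁻¹) u :=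
    ContinuousAt.inv₀ (by fun_prop) (hne u hu)
  have hd1 : ContinuousAt
      (fun u : (Fin p → ℝ) × ℝ × (Fin p → ℝ) × ℝ => z.2 ⬝ᵥ u.1) u :=
    ((continuous_dotProduct_left z.2).comp continuous_fst).continuousAt
  have hd3 : ContinuousAt
      (fun u : (Fin p → ℝ) × ℝ × (Fin p → ℝ) × ℝ => z.2 ⬝ᵥ u.2.2.1) u :=
    ((continuous_dotProduct_left z.2).comp (by fun_prop)).continuousAt
  have hcont : ContinuousAt (fun u => m.scoreParam θ u z) u := by
    simp only [scoreParam_eq]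
    fun_prop
  exact hcont.tendsto.comp hlim

/-! ### The envelope -/

/-- `W` is the sum of `|F|`, `|Fdot|` and the envelopes of the two linear predictors. In the bound,
`|F| ^ 8 ≤ 1 + F ^ 14` contributes `1 + |M|`, both for `F` and for its predictor; the `Fdot` terms
contribute `|M|` each. -/
theorem exists_envelopes_of_complexity (hm : m.IsModel) {V Vdot : ℕ} {M : ℝ}
    (hT : m.TransformationComplexity V Vdot M) :
    ∃ (F Fdot : ℝ → ℝ) (G Gdot : (Fin p → ℝ) → ℝ) (W : ℝ × (Fin p → ℝ) → ℝ),
      Measurable W ∧ (∀ z, 0 ≤ W z) ∧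
      (∀ z, F z.1 + G z.2 ≤ W z) ∧ (∀ z, Fdot z.1 + Gdot z.2 ≤ W z) ∧
      IsEnvelope m.𝒴 (m.Λ '' m.Θ) F ∧ IsEnvelope m.𝒴 (m.Λdot '' m.Θ) Fdot ∧
      (∀ x ∈ m.𝒳, ∀ θ ∈ m.Θ, |x ⬝ᵥ m.β θ| ≤ G x) ∧
      (∀ x ∈ m.𝒳, ∀ θ ∈ m.Θ, |x ⬝ᵥ m.βdot θ| ≤ Gdot x) ∧
      Integrable (fun z => (1 + W z) ^ 8) m.P ∧
      ∫ z, (1 + W z) ^ 8 ∂m.P ≤ 2 ^ 21 * (3 + 4 * |M|) := by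
  have := hm.prob
  obtain ⟨hmeas, -, -, ⟨F, hFm, hF, hF14, hFM⟩, ⟨Fdot, hFdm, hFd, hF8, hFdM⟩⟩ := hT
  have hFabs : IsEnvelope m.𝒴 (m.Λ '' m.Θ) fun y => |F y| := fun f hf y hy =>
    (hF f hf y hy).trans (le_abs_self _)
  have hFdabs : IsEnvelope m.𝒴 (m.Λdot '' m.Θ) fun y => |Fdot y| := fun f hf y hy =>
    (hFd f hf y hy).trans (le_abs_self _)
  have hF14le : ∀ t : ℝ, |t| ^ 8 ≤ 1 + t ^ 14 := fun t => by
    rw [← Even.pow_abs (by decide : Even 14) t]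
    rcases le_total |t| 1 with h | h
    · have := pow_le_one₀ (n := 8) (abs_nonneg t) h
      have : 0 ≤ |t| ^ 14 := by positivity
      linarith
    · have := pow_le_pow_right₀ h (by norm_num : 8 ≤ 14)
      linarith
  have hle8 : ∀ t : ℝ, 0 ≤ t → t ≤ 1 + t ^ 8 := fun t ht => by
    rcases le_total t 1 with h | h
    · have : 0 ≤ t ^ 8 := by positivity
      linarith
    · have := le_self_pow₀ h (by norm_num : 8 ≠ 0)
      linarith
  have iF8 : Integrable (fun z : ℝ × (Fin p → ℝ) => |F z.1| ^ 8) m.P := by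
    refine ((integrable_const 1).add hF14).mono'
      ((hFm.comp measurable_fst).abs.pow_const 8).aestronglyMeasurable (.of_forall fun z => ?_)
    rw [Real.norm_of_nonneg (by positivity)]
    exact hF14le _
  have bF8 : ∫ z, |F z.1| ^ 8 ∂m.P ≤ 1 + |M| := by
    refine (integral_mono iF8 ((integrable_const 1).add hF14) fun z => hF14le _).trans ?_
    simp only [Pi.add_apply]
    rw [integral_add (integrable_const _) hF14]
    simp only [integral_const, probReal_univ, one_smul]
    linarith [le_abs_self M]
  have iFd8 : Integrable (fun z : ℝ × (Fin p → ℝ) => |Fdot z.1| ^ 8) m.P := by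
    simpa only [Even.pow_abs (by decide : Even 8)] using hF8
  have bFd8 : ∫ z, |Fdot z.1| ^ 8 ∂m.P ≤ |M| := by
    simpa only [Even.pow_abs (by decide : Even 8)] using hFdM.trans (le_abs_self M)
  have int1 : ∀ H : ℝ → ℝ, Measurable H → Integrable (fun z : ℝ × (Fin p → ℝ) => |H z.1| ^ 8) m.P →
      Integrable (fun z => |H z.1|) m.P := fun H hH hH8 => by
    refine ((integrable_const 1).add hH8).mono'
      (hH.comp measurable_fst).abs.aestronglyMeasurable (.of_forall fun z => ?_)
    rw [Real.norm_of_nonneg (by positivity)]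
    exact hle8 _ (abs_nonneg _)
  obtain ⟨G, Gdot, hG, hGd, hG0, hGd0, hGβ, hGdβ, iG8, iGd8, bG8, bGd8⟩ :=
    exists_linear_envelopes hm (fun θ hθ => ⟨(hmeas θ hθ).1, (hmeas θ hθ).2.1⟩)
      (fun y => abs_nonneg (F y)) (fun y => abs_nonneg (Fdot y)) hFabs hFdabs
      (int1 F hFm iF8) (int1 Fdot hFdm iFd8) 8 iF8 iFd8
  have hWm : Measurable fun z : ℝ × (Fin p → ℝ) => (|F z.1| + |Fdot z.1|) + (G z.2 + Gdot z.2) :=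
    ((hFm.comp measurable_fst).abs.add (hFdm.comp measurable_fst).abs).add
      ((hG.comp measurable_snd).add (hGd.comp measurable_snd))
  -- Three nested uses of `(a + b) ^ 8 ≤ 2 ^ 7 * (a ^ 8 + b ^ 8)` give the factor `2 ^ 21`.
  have hpt : ∀ z : ℝ × (Fin p → ℝ), (1 + ((|F z.1| + |Fdot z.1|) + (G z.2 + Gdot z.2))) ^ 8 ≤
      2 ^ 21 * (1 + ((|F z.1| ^ 8 + |Fdot z.1| ^ 8) + (G z.2 ^ 8 + Gdot z.2 ^ 8))) := fun z => by
    have a1 := hG0 z.2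
    have a2 := hGd0 z.2
    have k1 := add_pow_le (abs_nonneg (F z.1)) (abs_nonneg (Fdot z.1)) 8
    have k2 := add_pow_le a1 a2 8
    have k3 := add_pow_le (add_nonneg (abs_nonneg (F z.1)) (abs_nonneg (Fdot z.1)))
      (add_nonneg a1 a2) 8
    have k4 := add_pow_le zero_le_one (add_nonneg (add_nonneg (abs_nonneg (F z.1))
      (abs_nonneg (Fdot z.1))) (add_nonneg a1 a2)) 8
    norm_num at k1 k2 k3 k4 ⊢
    linarith
  have iS : Integrable (fun z : ℝ × (Fin p → ℝ) =>
      2 ^ 21 * (1 + ((|F z.1| ^ 8 + |Fdot z.1| ^ 8) + (G z.2 ^ 8 + Gdot z.2 ^ 8)))) m.P :=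
    ((integrable_const 1).add ((iF8.add iFd8).add (iG8.add iGd8))).const_mul _
  have iW : Integrable (fun z : ℝ × (Fin p → ℝ) =>
      (1 + ((|F z.1| + |Fdot z.1|) + (G z.2 + Gdot z.2))) ^ 8) m.P := by
    refine iS.mono' ((measurable_const.add hWm).pow_const 8).aestronglyMeasurable
      (.of_forall fun z => ?_)
    rw [Real.norm_of_nonneg (by positivity)]
    exact hpt z
  refine ⟨fun y => |F y|, fun y => |Fdot y|, G, Gdot,
    fun z => (|F z.1| + |Fdot z.1|) + (G z.2 + Gdot z.2), hWm, fun z => ?_, fun z => ?_,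
    fun z => ?_, hFabs, hFdabs, hGβ, hGdβ, iW, (integral_mono iW iS hpt).trans ?_⟩
  · have := hG0 z.2
    have := hGd0 z.2
    positivity
  · have := hGd0 z.2
    have := abs_nonneg (Fdot z.1)
    linarith
  · have := hG0 z.2
    have := abs_nonneg (F z.1)
    linarith
  · have e : ∫ z : ℝ × (Fin p → ℝ), (2 : ℝ) ^ 21 *
        (1 + ((|F z.1| ^ 8 + |Fdot z.1| ^ 8) + (G z.2 ^ 8 + Gdot z.2 ^ 8))) ∂m.P =
        2 ^ 21 * (1 + ((∫ z, |F z.1| ^ 8 ∂m.P + ∫ z, |Fdot z.1| ^ 8 ∂m.P) +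
          (∫ z, G z.2 ^ 8 ∂m.P + ∫ z, Gdot z.2 ^ 8 ∂m.P))) := by
      have j1 : Integrable (fun z : ℝ × (Fin p → ℝ) => |F z.1| ^ 8 + |Fdot z.1| ^ 8) m.P :=
        iF8.add iFd8
      have j2 : Integrable (fun z : ℝ × (Fin p → ℝ) => G z.2 ^ 8 + Gdot z.2 ^ 8) m.P :=
        iG8.add iGd8
      have j3 : Integrable (fun z : ℝ × (Fin p → ℝ) =>
          (|F z.1| ^ 8 + |Fdot z.1| ^ 8) + (G z.2 ^ 8 + Gdot z.2 ^ 8)) m.P := j1.add j2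
      rw [integral_const_mul, integral_add (integrable_const _) j3,
        integral_add j1 j2, integral_add iF8 iFd8, integral_add iG8 iGd8]
      simp
    rw [e]
    linarith

/-- The envelope is quadratic in `w`, so its fourth power needs `w ^ 8`; the quotient term uses `|J|
^ 4 ≤ 1 + J ^ 6`. -/
theorem integral_envelope_pow_le [IsProbabilityMeasure m.P] {A N M : ℝ}
    {w : ℝ × (Fin p → ℝ) → ℝ} {J : ℝ → ℝ} (hA : 0 ≤ A) (hw : Measurable w) (hJ : Measurable J)
    (hwi : Integrable (fun z => w z ^ 8) m.P) (hwI : ∫ z, w z ^ 8 ∂m.P ≤ N)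
    (hJi : Integrable (fun z => J z.1 ^ 6) m.P) (hJM : ∫ z, J z.1 ^ 6 ∂m.P ≤ M) :
    Integrable (fun z => (A * w z ^ 2 + |J z.1|) ^ (4 : ℝ)) m.P ∧
      ∫ z, (A * w z ^ 2 + |J z.1|) ^ (4 : ℝ) ∂m.P ≤ 8 * (A ^ 4 * N + (1 + M)) := by
  have hle : ∀ z : ℝ × (Fin p → ℝ), (A * w z ^ 2 + |J z.1|) ^ 4 ≤
      8 * (A ^ 4 * w z ^ 8 + (1 + J z.1 ^ 6)) := fun z => by
    have h1 := add_pow_le (by positivity : 0 ≤ A * w z ^ 2) (abs_nonneg (J z.1)) 4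
    have h2 : |J z.1| ^ 4 ≤ 1 + J z.1 ^ 6 := by
      rw [← Even.pow_abs (by decide : Even 6) (J z.1)]
      rcases le_total |J z.1| 1 with h | h
      · have := pow_le_one₀ (n := 4) (abs_nonneg (J z.1)) h
        have : 0 ≤ |J z.1| ^ 6 := by positivity
        linarith
      · have := pow_le_pow_right₀ h (by norm_num : 4 ≤ 6)
        linarith
    have h3 : (A * w z ^ 2) ^ 4 = A ^ 4 * w z ^ 8 := by ring
    rw [h3] at h1
    norm_num at h1 ⊢
    linarith
  have hi : Integrable (fun z : ℝ × (Fin p → ℝ) => 8 * (A ^ 4 * w z ^ 8 + (1 + J z.1 ^ 6))) m.P :=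
    ((hwi.const_mul _).add ((integrable_const 1).add hJi)).const_mul _
  have hψ : Integrable (fun z => (A * w z ^ 2 + |J z.1|) ^ 4) m.P := by
    refine hi.mono' ((((hw.pow_const 2).const_mul A).add
      (hJ.comp measurable_fst).abs).pow_const 4).aestronglyMeasurable (.of_forall fun z => ?_)
    rw [Real.norm_of_nonneg (by positivity)]
    exact hle z
  simp only [Real.rpow_ofNat]
  refine ⟨hψ, (integral_mono hψ hi hle).trans ?_⟩
  have e : ∫ z : ℝ × (Fin p → ℝ), 8 * (A ^ 4 * w z ^ 8 + (1 + J z.1 ^ 6)) ∂m.P =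
      8 * (A ^ 4 * ∫ z, w z ^ 8 ∂m.P + (1 + ∫ z, J z.1 ^ 6 ∂m.P)) := by
    have hJ1 : Integrable (fun z : ℝ × (Fin p → ℝ) => 1 + J z.1 ^ 6) m.P :=
      (integrable_const 1).add hJi
    rw [integral_const_mul, integral_add (hwi.const_mul _) hJ1, integral_const_mul,
      integral_add (integrable_const _) hJi]
    simp
  rw [e]
  gcongr

/-- For coefficients in the nuisance realization set, the ingredients of the score are bounded
relative to the envelopes. -/
theorem paramSet_ingredients_le {n s : ℕ} {c C K N θ r : ℝ} (hc : 0 < c) (hC : 0 < C) (hN : 0 ≤ N)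
    (hr : C * (n : ℝ) ^ (-(1 / 4) : ℝ) ≤ r) (hr1 : r ≤ C) (hr2 : r ≤ c / 2)
    (hθ : θ ∈ m.Θ) (hK : m.BoundedSupport K)
    {F Fdot : ℝ → ℝ} {G Gdot : (Fin p → ℝ) → ℝ} {W : ℝ × (Fin p → ℝ) → ℝ}
    (hF : IsEnvelope m.𝒴 (m.Λ '' m.Θ) F) (hFdot : IsEnvelope m.𝒴 (m.Λdot '' m.Θ) Fdot)
    (hG : ∀ x ∈ m.𝒳, ∀ θ ∈ m.Θ, |x ⬝ᵥ m.β θ| ≤ G x)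
    (hGdot : ∀ x ∈ m.𝒳, ∀ θ ∈ m.Θ, |x ⬝ᵥ m.βdot θ| ≤ Gdot x) (hW0 : ∀ z, 0 ≤ W z)
    (hW : ∀ z, F z.1 + G z.2 ≤ W z) (hWdot : ∀ z, Fdot z.1 + Gdot z.2 ≤ W z)
    (hσ : c ≤ m.σsq θ) (hσdot : |m.σsqdot θ| ≤ 2 * N)
    {E : ℝ} (hE : E = 1 + 2 / c + 4 / c ^ 2 + 2 * N + C + |K| * C + |K|)
    {u : (Fin p → ℝ) × ℝ × (Fin p → ℝ) × ℝ} (hu : u ∈ m.paramSet n s C θ) :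
    c / 2 ≤ u.2.1 ∧ |(u.2.1)⁻¹| ≤ E ∧ |u.2.2.2| ≤ E ∧
      ∀ z ∈ m.domain, |m.Λ θ z.1 - z.2 ⬝ᵥ u.1| ≤ E * (1 + W z) ∧
        |m.Λdot θ z.1 - z.2 ⬝ᵥ u.2.2.1| ≤ E * (1 + W z) := by
  obtain ⟨⟨-, h1⟩, h2, ⟨-, h3⟩, h4⟩ := paramSet_bounds hθ hu
  have p1 : 0 ≤ 2 / c := by positivity
  have p2 : 0 ≤ 4 / c ^ 2 := by positivity
  have p3 : 0 ≤ |K| * C := by positivity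
  have p4 := abs_nonneg K
  have hu2 : c / 2 ≤ u.2.1 := by linarith [(abs_le.1 (h2.trans (hr.trans hr2))).1]
  have hlin : ∀ (A : ℝ) (x b v : Fin p → ℝ) (g f w : ℝ), (∀ j, |x j| ≤ K) → |A| ≤ f →
      |x ⬝ᵥ b| ≤ g → f + g ≤ w → 0 ≤ w → ∑ j, |v j - b j| ≤ C * (n : ℝ) ^ (-(1 / 4) : ℝ) →
      |A - x ⬝ᵥ v| ≤ E * (1 + w) := by
    intro A x b v g f w hx hA hb hw hw0 hv
    have e : A - x ⬝ᵥ v = A - x ⬝ᵥ b - x ⬝ᵥ (v - b) := by rw [dotProduct_sub]; ring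
    have h := (abs_dotProduct_le hx (v - b)).trans
      (mul_le_mul_of_nonneg_left (hv.trans (hr.trans hr1)) p4)
    have hE1 : 1 + |K| * C ≤ E := by linarith
    rw [e]
    have := (abs_sub _ _).trans (add_le_add ((abs_sub _ _).trans (add_le_add hA hb)) h)
    nlinarith
  refine ⟨hu2, ?_, ?_, fun z hz => ⟨?_, ?_⟩⟩
  · rw [abs_inv, abs_of_pos (by linarith)]
    have : (u.2.1)⁻¹ ≤ (c / 2)⁻¹ := inv_anti₀ (by positivity) hu2
    rw [inv_div] at this
    linarith
  · have := (abs_sub_abs_le_abs_sub _ _).trans (h4.trans (hr.trans hr1))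
    linarith
  · exact hlin _ _ _ _ _ _ _ (hK _ hz.2) (hF _ (mem_image_of_mem _ hθ) _ hz.1)
      (hG _ hz.2 θ hθ) (hW z) (hW0 z) h1
  · exact hlin _ _ _ _ _ _ _ (hK _ hz.2) (hFdot _ (mem_image_of_mem _ hθ) _ hz.1)
      (hGdot _ hz.2 θ hθ) (hWdot z) (hW0 z) h3

end ModelData

/-- The bound `c / 2` keeps `h₂` at least `c / 2` when `σ²_θ ≥ c`; the bound `C` makes the nuisance
errors bounded by a constant free of `n`. -/
theorem exists_forall_mul_rpow_neg_le {c C : ℝ} (hc : 0 < c) (hC : 0 < C) :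
    ∃ n₁ : ℕ, 1 ≤ n₁ ∧ ∀ n : ℕ, n₁ ≤ n →
      C * (n : ℝ) ^ (-(1 / 4) : ℝ) ≤ min C (c / 2) := by
  have h := ((tendsto_rpow_neg_atTop (by norm_num : (0 : ℝ) < 1 / 4)).comp
    tendsto_natCast_atTop_atTop).const_mul C
  rw [mul_zero] at h
  obtain ⟨N, hN⟩ := eventually_atTop.1
    (h.eventually (eventually_le_nhds (lt_min hC (half_pos hc))))
  exact ⟨max 1 N, le_max_left _ _, fun n hn => hN n ((le_max_right _ _).trans hn)⟩

end HDTransform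

/-! ### The main theorem: choice of constants and assembly -/

open HDTransform HDTransform.ModelData

/-- The constants `q, C₁, C₂, n₁` depend only on the constants `c, C, K, M, V, Vdot` in the
assumptions, so they are uniform in the sample size, the number of covariates, the sparsity index,
the law of `(Y, X)` and `θ`. -/
theorem mainTheorem6 (c C K M : ℝ) (V Vdot : ℕ) (hc : 0 < c) (hC : 0 < C) :
    ∃ q : ℝ, 4 ≤ q ∧ ∃ C₁ : ℝ, 0 < C₁ ∧ ∃ C₂ : ℝ, 0 < C₂ ∧ ∃ n₁ : ℕ,
      ∀ n : ℕ, n₁ ≤ n → ∀ (p s : ℕ) (m : HDTransform.ModelData p), 1 ≤ s →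
        m.IsModel → m.IsSparse s → m.BoundedSupport K → m.ErrorVarianceBound c →
        m.TransformationComplexity V Vdot M → m.QuotientEnvelope M →
        ∃ ψbar : ℝ × (Fin p → ℝ) → ℝ, Measurable ψbar ∧
          (Integrable (fun z => ψbar z ^ q) m.P ∧ ∫ z, ψbar z ^ q ∂m.P ≤ C₁) ∧
          ∀ θ ∈ m.Θ,
            HDTransform.IsEnvelope m.domain (m.scoreClass n s C θ) ψbar ∧
            HDTransform.IsPointwiseMeasurable m.domain (m.scoreClass n s C θ) ∧
            ∀ ε : ℝ, 0 < ε → ε ≤ 1 →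
              HDTransform.uniformEntropy m.domain 2 (m.scoreClass n s C θ) ψbar ε ≤
                ((C₁ * s * Real.log (C₂ * (max p n : ℕ) / ε) : ℝ) : EReal) := by
  obtain ⟨n₁, hn₁, hrate⟩ := exists_forall_mul_rpow_neg_le hc hC
  obtain ⟨N, hN⟩ : ∃ N : ℝ, N = 2 ^ 21 * (3 + 4 * |M|) := ⟨_, rfl⟩
  have hN0 : 0 ≤ N := by rw [hN]; positivity
  -- One constant for everything: `2 / c` bounds `1/h₂` and `4 / c ^ 2` its Lipschitz constant, `2 *
  -- N + C` bounds `h₄`, `1 + |K| * C` bounds the residuals relative to `1 + W`, and `|K|` is the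
  -- `ℓ₁`-Lipschitz constant of the predictors.
  obtain ⟨E, hE⟩ : ∃ E : ℝ, E = 1 + 2 / c + 4 / c ^ 2 + 2 * N + C + |K| * C + |K| := ⟨_, rfl⟩
  have p1 : 0 ≤ 2 / c := by positivity
  have p2 : 0 ≤ 4 / c ^ 2 := by positivity
  have p3 : 0 ≤ |K| * C := by positivity
  have p4 := abs_nonneg K
  have hE1 : 1 ≤ E := by linarith
  have hE0 : 0 ≤ E := by linarith
  have hmoment : 0 ≤ 8 * ((7 * E ^ 5) ^ 4 * N + (1 + |M|)) := by positivity
  -- The same `C₁` must bound the moment and the entropy factor; the sum of the two bounds does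
  -- both.
  refine ⟨4, le_rfl, (4 * C + 4) + 8 * ((7 * E ^ 5) ^ 4 * N + (1 + |M|)), by linarith,
    16 * C + 2, by positivity, n₁, ?_⟩
  intro n hn p s m hs hm _ hK hvar hT hJ
  have := hm.prob
  have hmeas := hT.1
  have hr := hrate n hn
  obtain ⟨F, Fdot, G, Gdot, W, hWm, hW0, hW, hWdot, hF, hFdot, hG, hGdot, hWi, hWI⟩ :=
    exists_envelopes_of_complexity hm hT
  rw [← hN] at hWI
  obtain ⟨J, hJm, hJe, hJi, hJM⟩ := hJ
  have hmom := integral_envelope_pow_le (A := 7 * E ^ 5) (by positivity)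
    (measurable_const.add hWm) hJm hWi hWI hJi (hJM.trans (le_abs_self M))
  set ψ : ℝ × (Fin p → ℝ) → ℝ := fun z => 7 * E ^ 5 * (1 + W z) ^ 2 + |J z.1| with hψ
  have hψm : Measurable ψ :=
    (((measurable_const.add hWm).pow_const 2).const_mul _).add (hJm.comp measurable_fst).abs
  refine ⟨ψ, hψm, ⟨hmom.1, hmom.2.trans (le_add_of_nonneg_left (by linarith))⟩, fun θ hθ => ?_⟩
  have hσ : c ≤ m.σsq θ := (hvar θ hθ).1.trans_eq (σsq_eq_integral hm hθ).symm
  have hW2 : ∀ z, W z ^ 2 ≤ (1 + W z) ^ 8 := fun z =>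
    (pow_le_pow_left₀ (hW0 z) (by linarith) 2).trans
      (pow_le_pow_right₀ (by linarith [hW0 z]) (by norm_num))
  have hW2i : Integrable (fun z => W z ^ 2) m.P :=
    hWi.mono' (hWm.pow_const 2).aestronglyMeasurable (.of_forall fun z => by
      rw [Real.norm_of_nonneg (by positivity)]
      exact hW2 z)
  have hσdot : |m.σsqdot θ| ≤ 2 * N :=
    (abs_σsqdot_le hm (fun θ hθ => (hmeas θ hθ).1) hF hFdot hG hGdot hW hWdot hW2i hθ).trans
      (mul_le_mul_of_nonneg_left ((integral_mono hW2i hWi hW2).trans hWI) zero_le_two)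
  have hing := fun (u : (Fin p → ℝ) × ℝ × (Fin p → ℝ) × ℝ) (hu : u ∈ m.paramSet n s C θ) =>
    paramSet_ingredients_le hc hC hN0 hr (min_le_left _ _) (min_le_right _ _) hθ hK hF hFdot hG
      hGdot hW0 hW hWdot hσ hσdot hE hu
  have hw1 : ∀ z, 1 ≤ 1 + W z := fun z => by linarith [hW0 z]
  have hsm : ∀ u, Measurable (m.domain.domRestrict (m.scoreParam θ u)) :=
    measurable_scoreParam (hmeas θ hθ).1 (hmeas θ hθ).2.1 (hmeas θ hθ).2.2.1 (hmeas θ hθ).2.2.2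
  have henv : ∀ u ∈ m.paramSet n s C θ, ∀ z ∈ m.domain, |m.scoreParam θ u z| ≤ ψ z := by
    intro u hu z hz
    obtain ⟨-, h1, h2, h3⟩ := hing u hu
    rw [scoreParam_eq]
    refine (abs_add_le _ _).trans (add_le_add ?_ ?_)
    · exact abs_score_polynomial_le hE1 (hw1 z) h1 h2 (h3 z hz).1 (h3 z hz).2
    · exact (hJe _ (mem_image_of_mem _ hθ) _ hz.1).trans (le_abs_self _)
  refine ⟨?_, isPointwiseMeasurable_scoreClass hθ hsm fun u hu =>
    ((half_pos hc).trans_le (hing u hu).1).ne', fun ε hε hε1 => ?_⟩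
  · rw [scoreClass_eq_image hθ]
    rintro _ ⟨u, hu, rfl⟩
    exact henv u hu
  · have hcoord : ∀ (v b : Fin p → ℝ), ∑ j, |v j - b j| ≤ C * (n : ℝ) ^ (-(1 / 4) : ℝ) →
        ∀ j, |v j - b j| ≤ C := fun v b h j =>
      (Finset.single_le_sum (f := fun j => |v j - b j|) (fun j _ => abs_nonneg _)
        (Finset.mem_univ j)).trans (h.trans (hr.trans (min_le_left _ _)))
    have hbd := fun (u : (Fin p → ℝ) × ℝ × (Fin p → ℝ) × ℝ) (hu : u ∈ m.paramSet n s C θ) =>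
      paramSet_bounds hθ hu
    have hrC := hr.trans (min_le_left _ _)
    have hent := uniformEntropy_le_of_sparse_lipschitz (hn₁.trans hn) hs hC.le hε hε1
      (measurableSet_domain hm) (m.paramSet n s C θ) (m.scoreParam θ) ψ hψm (m.β θ) (m.βdot θ)
      (m.σsq θ) (m.σsqdot θ) (fun u hu => ⟨(hbd u hu).1.1, hcoord _ _ (hbd u hu).1.2⟩)
      (fun u hu => (hbd u hu).2.1.trans hrC)
      (fun u hu => ⟨(hbd u hu).2.2.1.1, hcoord _ _ (hbd u hu).2.2.1.2⟩)
      (fun u hu => (hbd u hu).2.2.2.trans hrC) (fun u _ => hsm u) henv (by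
        intro u hu v hv η hη d1 d2 d3 d4 z hz
        obtain ⟨u0, u1, u2, u3⟩ := hing u hu
        obtain ⟨v0, v1, v2, v3⟩ := hing v hv
        have hlin : ∀ (A : ℝ) (a b : Fin p → ℝ), ∑ j, |a j - b j| ≤ η →
            |(A - z.2 ⬝ᵥ a) - (A - z.2 ⬝ᵥ b)| ≤ E * η * (1 + W z) := by
          intro A a b hab
          rw [show (A - z.2 ⬝ᵥ a) - (A - z.2 ⬝ᵥ b) = -(z.2 ⬝ᵥ (a - b)) by
            rw [dotProduct_sub]; ring, abs_neg]
          refine (abs_dotProduct_le (hK _ hz.2) _).trans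
            ((mul_le_mul_of_nonneg_left hab p4).trans ?_)
          refine (mul_le_mul_of_nonneg_right (by linarith : |K| ≤ E) hη).trans ?_
          exact le_mul_of_one_le_right (by positivity) (hw1 z)
        have hinv : |(u.2.1)⁻¹ - (v.2.1)⁻¹| ≤ E * η := by
          have hu0 : 0 < u.2.1 := (half_pos hc).trans_le u0
          have hv0 : 0 < v.2.1 := (half_pos hc).trans_le v0
          rw [inv_sub_inv hu0.ne' hv0.ne', abs_div, abs_sub_comm, abs_of_pos (mul_pos hu0 hv0),
            div_le_iff₀ (mul_pos hu0 hv0)]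
          have h1 : c / 2 * (c / 2) ≤ u.2.1 * v.2.1 :=
            mul_le_mul u0 v0 (by positivity) hu0.le
          have h2 : 1 ≤ E * (u.2.1 * v.2.1) := by
            calc (1 : ℝ) = 4 / c ^ 2 * (c / 2 * (c / 2)) := by field_simp; norm_num
              _ ≤ E * (u.2.1 * v.2.1) := mul_le_mul (by linarith) h1 (by positivity) hE0
          nlinarith
        have hpoly := abs_score_polynomial_sub_le hE1 (hw1 z) hη u1 u2 (u3 z hz).1 v1 v2
          (v3 z hz).1 (v3 z hz).2 hinv (d4.trans (le_mul_of_one_le_left hη hE1))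
          (hlin (m.Λ θ z.1) _ _ d1) (hlin (m.Λdot θ z.1) _ _ d3)
        -- The term `c_θ` cancels in increments, so it affects only the envelope.
        rw [scoreParam_eq, scoreParam_eq, add_sub_add_right_eq_sub]
        refine hpoly.trans (mul_le_mul_of_nonneg_left ?_ hη)
        exact le_add_of_nonneg_right (abs_nonneg _))
    rw [scoreClass_eq_image hθ]
    refine hent.trans (EReal.coe_le_coe_iff.2 ?_)
    have hlog : 0 ≤ Real.log ((16 * C + 2) * (max p n : ℕ) / ε) := by
      refine Real.log_nonneg ?_
      rw [le_div_iff₀ hε]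
      have : (1 : ℝ) ≤ (max p n : ℕ) := by
        exact_mod_cast (hn₁.trans hn).trans (le_max_right p n)
      nlinarith
    refine mul_le_mul_of_nonneg_right (mul_le_mul_of_nonneg_right ?_ (by positivity)) hlog
    exact le_add_of_nonneg_right hmoment
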